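/- Let $q$ be a prime power and let $m,l,k$ be positive integers with $3\le k\le\min\{m+1,l\}$. Let $V=\mathrm{GF}(q^l)^m$, regarded as an $ml$-dimensional vector space over $\mathrm{GF}(q)$ (so $V\cong\mathrm{GF}(q)^{ml}$), and let $\mathcal G$ be the Desarguesian $l$-spread of $V$, i.e. the set of all $1$-dimensional $\mathrm{GF}(q^l)$-subspaces of $V$, regarded as $l$-dimensional $\mathrm{GF}(q)$-subspaces. A $(v,g,k,\lambda)_q$-GDD is a triple $(V,\mathcal G,\mathcal B)$ where $V$ is a $v$-dimensional vector space over $\mathrm{GF}(q)$, $\mathcal G$ is a set of $g$-dimensional subspaces of $V$ (groups) such that every $1$-dimensional subspace of $V$ lies in exactly one group, and $\mathcal B$ is a collection (repetitions allowed) of $k$-dimensional subspaces of $V$ (blocks) such that $\dim(B\cap G)\le 1$ for all $B\in\mathcal B$, $G\in\mathcal G$, and every $2$-dimensional subspace of $V$ not contained in any group is contained in exactly $\lambda$ blocks. It is simple if $\mathcal B$ contains no repeated blocks. A group of linear bijections of $V$ is an automorphism group of it if each of its elements maps $\mathcal G$ onto $\mathcal G$ and $\mathcal B$ onto $\mathcal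 B$. For a positive integer $u\mid\gcd(d,v)$ put $$n_{d,u}^v=\frac{q^u-1}{q^v-1}\sum_{t:\,u\mid t\mid\gcd(d,v)}\mu(t/u)\begin{bmatrix} v/t\\ d/t\end{bmatrix}_{q^t},\qquad \begin{bmatrix} n\\ d\end{bmatrix}_{Q}=\prod_{i=0}^{d-1}\frac{Q^{n-i}-1}{Q^{d-i}-1},$$ where $\mu$ is the Möbius function. (This is the number of orbits of $\mathrm{GF}(q^v)^*$, acting by multiplication, on the $d$-dimensional $\mathrm{GF}(q)$-subspaces of $\mathrm{GF}(q^v)$ with stabilizer $\mathrm{GF}(q^u)^*$.) Then for all integers $w_{r,u}$ with $0\le w_{r,u}\le n_{r+1,u}^l$ (where $2\le r\le k-1$ and $u\mid\gcd(r+1,l)$) and every $w\in\{0,1\}$, there is a simple $(ml,l,k,\lambda)_q$-GDD on $V$ whose set of groups is $\mathcal G$ and which admits $\mathrm{GL}(m,q^l)$ as an automorphism group, where $$\lambda=\sum_{r=2}^{k-1}\ \sum_{u\mid\gcd(r+1,l)}w_{r,u}\,\frac{(q^k-1)(q^k-q)\prod_{j=2}^{k-2}(q^{ml}-q^{jl})}{(q^u-1)\prod_{j=r+1}^{k-1}(q^k-q^j)}\;+\;w\,q^{(l-1)\left(\binom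 k2-1\right)}\prod_{j=2}^{k-1}\frac{q^{(m-j)l}-1}{q^{k-j}-1}.$$ -/

import Mathlib

/-- The multiset of images of the subspaces in `B` under a bijective linear map `g`. -/
def imageBlocks {K V : Type*} [Field K] [AddCommGroup V] [Module K V]
    (g : V ≃ₗ[K] V) (B : Multiset (Submodule K V)) : Multiset (Submodule K V) :=
  B.map (fun S => S.map (g : V →ₗ[K] V))

open Classical in
/-- `(V, 𝒢, B)` is a `(v, g, k, lam)_q`-GDD, the `q`-analog of a group divisible design, where
`q` is the number of elements of the finite field `K`: `V` has dimension `v` over `K`; `𝒢` is a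
set of `g`-dimensional subspaces (the groups) such that every `1`-dimensional subspace lies in
exactly one of them; `B` is a collection of `k`-dimensional subspaces (the blocks), in which a
subspace may be repeated; every block meets every group in dimension at most one; and every
`2`-dimensional subspace that lies in no group is contained in exactly `lam` blocks, counted with
multiplicity. -/
structure IsQGDD {K V : Type*} [Field K] [Finite K] [AddCommGroup V] [Module K V]
    (v g k lam : ℕ) (𝒢 : Set (Submodule K V)) (B : Multiset (Submodule K V)) : Prop where
  finiteDimensional : FiniteDimensional K V
  finrank_space : Module.finrank K V = v
  finrank_group : ∀ G ∈ 𝒢, Module.finrank K G = g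
  existsUnique_group : ∀ P : Submodule K V, Module.finrank K P = 1 → ∃! G, G ∈ 𝒢 ∧ P ≤ G
  finrank_block : ∀ S ∈ B, Module.finrank K S = k
  finrank_block_inf_group : ∀ S ∈ B, ∀ G ∈ 𝒢, Module.finrank K (S ⊓ G : Submodule K V) ≤ 1
  card_blocks : ∀ T : Submodule K V, Module.finrank K T = 2 → (∀ G ∈ 𝒢, ¬ T ≤ G) →
    Multiset.card (B.filter (fun S => T ≤ S)) = lam

/-- The linear bijection `g` is an automorphism of the `q`-GDD `(V, 𝒢, B)`: it maps the set of
groups onto itself, and the collection of blocks onto itself with multiplicities. -/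
def IsGDDAutomorphism {K V : Type*} [Field K] [AddCommGroup V] [Module K V]
    (𝒢 : Set (Submodule K V)) (B : Multiset (Submodule K V)) (g : V ≃ₗ[K] V) : Prop :=
  (fun S : Submodule K V => S.map (g : V →ₗ[K] V)) '' 𝒢 = 𝒢 ∧ imageBlocks g B = B

/-- The Desarguesian spread of an `L`-vector space `V` over a subfield `K` of `L`: the
`1`-dimensional `L`-subspaces of `V`, regarded as `K`-subspaces. -/
def desarguesianSpread (K L V : Type*) [Field K] [Field L] [Algebra K L] [AddCommGroup V]
    [Module K V] [Module L V] [IsScalarTower K L V] : Set (Submodule K V) :=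
  {S | ∃ W : Submodule L V, Module.finrank L W = 1 ∧ W.restrictScalars K = S}

/-- The Gaussian binomial coefficient
`(Q^n - 1)(Q^(n-1) - 1) ⋯ (Q^(n-d+1) - 1) / ((Q^d - 1)(Q^(d-1) - 1) ⋯ (Q - 1))`. -/
def gaussBinom (Q n d : ℕ) : ℚ :=
  ∏ i ∈ Finset.range d, ((Q : ℚ) ^ (n - i) - 1) / ((Q : ℚ) ^ (d - i) - 1)

/-- The number `n_{d,u}^v`, that is
`(q^u - 1)/(q^v - 1) * ∑ μ(t/u) * gaussBinom (q^t) (v/t) (d/t)`, the sum being over the divisors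
`t` of `gcd(d, v)` that are multiples of `u`. -/
def singerOrbitNumber (q v d u : ℕ) : ℚ :=
  ((q : ℚ) ^ u - 1) / ((q : ℚ) ^ v - 1) *
    ∑ t ∈ (Nat.gcd d v).divisors with u ∣ t,
      (ArithmeticFunction.moebius (t / u) : ℚ) * gaussBinom (q ^ t) (v / t) (d / t)

/-- The number of blocks through a `2`-subspace which one orbit with parameters `r`, `u`
contributes. -/
def orbitIndex (q m l k r u : ℕ) : ℚ :=
  (((q : ℚ) ^ k - 1) * ((q : ℚ) ^ k - q) *
      ∏ j ∈ Finset.Icc 2 (k - 2), ((q : ℚ) ^ (m * l) - (q : ℚ) ^ (j * l))) /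
    (((q : ℚ) ^ u - 1) * ∏ j ∈ Finset.Icc (r + 1) (k - 1), ((q : ℚ) ^ k - (q : ℚ) ^ j))

/-- The number of `k`-subspaces through a `2`-subspace which belong to the orbit of those
`k`-subspaces whose span over the extension field has dimension `k`. -/
def fullOrbitIndex (q m l k : ℕ) : ℚ :=
  (q : ℚ) ^ ((l - 1) * (k.choose 2 - 1)) *
    ∏ j ∈ Finset.Icc 2 (k - 1), ((q : ℚ) ^ ((m - j) * l) - 1) / ((q : ℚ) ^ (k - j) - 1)

/-!
A `K`-subspace `S` of `V` with a basis `b` of size `k` is described, up to the action of `GL(V)`, by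
the module of `L`-linear relations of `b`. If this module is a line `L • x` with `x ∈ L ^ k`, then
the `K`-span of the entries of `x` is a subspace of `L` that is well defined up to multiplication by
a unit of `L`: a change of the basis `b` transforms `x` by an invertible matrix over `K`, which
does not change the span (`exists_relations_eq_span_of_span_eq`). Hence a family `𝒳` of subspaces of
`L` that is invariant under multiplication defines a `GL(V)`-invariant set of `k`-subspaces of `V`,
to which the set of those with `L`-independent bases may be added. These are the blocks.

Any two `K`-independent vectors of a block are the start of a basis of it. A dependence between them
over `L` would be a relation with at most two nonzero entries, whereas every nonzero relation
has a span in `𝒳`, of dimension at least three. So a block meets the members of the Desarguesian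
spread in dimension at most one (`isBlockClass_isBlockTuple`, `IsBlockClass.isQGDD`).

The index follows by counting tuples. The number of tuples that extend a given `L`-independent pair
and span a block does not depend on the pair: to choose one is to choose `x` up to a unit of `L`,
and then an `L`-independent family, because one of the vectors is determined by the others and `x`
(`natCard_relations_mul`). Dividing by the number of extensions of a pair to a basis of a given
block gives the number of blocks through the pair (`IsBlockClass.ncard_mul`). Only the number of
members of `𝒳` of each dimension enters.

It remains to find families `𝒳` of the required sizes. The units of `L` that stabilize a subspace
`X` of `L` are the nonzero elements of an intermediate field, and the subspaces with a stabilizer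
containing a given intermediate field `F` are the `F`-subspaces. Möbius inversion over the divisors
of the degree therefore gives the number of subspaces with dimension `d` and a stabilizer of
degree `u` (`natCard_finrank_multiplierField_eq`). The orbits of these all have the same size, so
any number of orbits up to `singerOrbitNumber` is available (`exists_invariant_family`).
-/

open Module

/-! ### Counting tuples of vectors over a finite field -/

theorem natCard_sigma_of_const {α : Type*} {β : α → Type*} [Finite α] [∀ a, Finite (β a)] {c : ℕ}
    (h : ∀ a, Nat.card (β a) = c) : Nat.card (Σ a, β a) = Nat.card α * c := by
  have := Fintype.ofFinite α
  rw [Nat.card_sigma]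
  simp [h]

theorem linearIndependent_sumElim_cons {F V ι : Type*} [Field F] [AddCommGroup V] [Module F V]
    (p : ι → V) {n : ℕ} (v : V) (s : Fin n → V) :
    LinearIndependent F (Sum.elim p (Fin.cons v s : Fin (n + 1) → V)) ↔
      LinearIndependent F (Sum.elim p s) ∧
        v ∉ Submodule.span F (Set.range (Sum.elim p s)) := by
  let e : Option (ι ⊕ Fin n) ≃ ι ⊕ Fin (n + 1) :=
    { toFun := fun o => o.elim (Sum.inr 0) (Sum.map id Fin.succ)
      invFun := Sum.elim (fun i => some (Sum.inl i))
        (Fin.cases none fun j => some (Sum.inr j))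
      left_inv := by rintro (_ | _ | _) <;> simp
      right_inv := by
        rintro (i | j)
        · simp
        · refine Fin.cases ?_ (fun j => ?_) j <;> simp }
  rw [← linearIndependent_equiv e, ← linearIndependent_option']
  have : (Sum.elim p (Fin.cons v s : Fin (n + 1) → V) ∘ e : Option (ι ⊕ Fin n) → V) =
      fun o => o.casesOn' v (Sum.elim p s) := by
    funext o
    rcases o with _ | _ | _ <;> simp [e]
  rw [this]

theorem natCard_linearIndependent_sumElim {F V ι : Type*} [Field F] [Finite F] [AddCommGroup V]
    [Module F V] [Finite V] [Fintype ι] {p : ι → V} (hp : LinearIndependent F p) (n : ℕ) :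
    Nat.card {s : Fin n → V // LinearIndependent F (Sum.elim p s)} =
      ∏ i ∈ Finset.range n,
        (Nat.card F ^ finrank F V - Nat.card F ^ (Fintype.card ι + i)) := by
  classical
  induction n with
  | zero =>
    have : ∀ s : Fin 0 → V, LinearIndependent F (Sum.elim p s) := fun s => by
      rw [← linearIndependent_equiv (Equiv.sumEmpty ι (Fin 0)).symm]
      convert! hp
    rw [Nat.card_congr (Equiv.subtypeUnivEquiv this)]
    simp
  | succ n ih =>
    let e : {s : Fin (n + 1) → V // LinearIndependent F (Sum.elim p s)} ≃
        Σ s : {s : Fin n → V // LinearIndependent F (Sum.elim p s)},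
          {v : V // v ∉ Submodule.span F (Set.range (Sum.elim p s.1))} :=
      { toFun := fun s =>
          have h := (linearIndependent_sumElim_cons p (s.1 0) (Fin.tail s.1)).1
            (by rw [Fin.cons_self_tail]; exact s.2)
          ⟨⟨Fin.tail s.1, h.1⟩, ⟨s.1 0, h.2⟩⟩
        invFun := fun s => ⟨Fin.cons s.2.1 s.1.1,
          (linearIndependent_sumElim_cons p _ _).2 ⟨s.1.2, s.2.2⟩⟩
        left_inv := fun s => Subtype.ext (Fin.cons_self_tail s.1)
        right_inv := fun s => rfl }
    have hfib : ∀ s : {s : Fin n → V // LinearIndependent F (Sum.elim p s)},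
        Nat.card {v : V // v ∉ Submodule.span F (Set.range (Sum.elim p s.1))} =
          Nat.card F ^ finrank F V - Nat.card F ^ (Fintype.card ι + n) := by
      intro s
      have h1 := natCard_eq_pow_finrank (K := F)
        (V := Submodule.span F (Set.range (Sum.elim p s.1)))
      rw [finrank_span_eq_card s.2, Fintype.card_sum, Fintype.card_fin] at h1
      have h2 := Set.ncard_compl
        (Submodule.span F (Set.range (Sum.elim p s.1)) : Set V)
      rw [← natCard_eq_pow_finrank, ← h1]
      exact h2
    rw [Nat.card_congr e, natCard_sigma_of_const hfib, Finset.prod_range_succ, ← ih]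

theorem natCard_linearIndependent_fin {F V : Type*} [Field F] [Finite F] [AddCommGroup V]
    [Module F V] [Finite V] (n : ℕ) :
    Nat.card {s : Fin n → V // LinearIndependent F s} =
      ∏ i ∈ Finset.range n, (Nat.card F ^ finrank F V - Nat.card F ^ i) := by
  have h := natCard_linearIndependent_sumElim (F := F) (V := V) (ι := Empty) (p := Empty.elim)
    (linearIndependent_empty_type) n
  simp only [Fintype.card_empty, zero_add] at h
  rw [← h]
  refine Nat.card_congr (Equiv.subtypeEquivRight fun s => ?_)
  rw [← linearIndependent_equiv (Equiv.emptySum Empty (Fin n)).symm]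
  exact iff_of_eq rfl

/-- The rank of a matrix is both its row rank and its column rank, so the families that span a
space of dimension `d` correspond, through coordinates, to the linearly independent `d`-tuples in
the coordinate space of the index type. -/
theorem natCard_span_range_eq {F V ι : Type*} [Field F] [Finite F] [AddCommGroup V]
    [Module F V] [Finite V] [Fintype ι] (X : Submodule F V) :
    Nat.card {x : ι → V // Submodule.span F (Set.range x) = X} =
      ∏ i ∈ Finset.range (finrank F X),
        (Nat.card F ^ Fintype.card ι - Nat.card F ^ i) := by
  classical
  have := natCard_linearIndependent_fin (F := F) (V := ι → F) (finrank F X)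
  rw [finrank_fintype_fun_eq_card] at this
  rw [← this]
  let c := finBasis F X
  have hspan : ∀ x : ι → X, Submodule.span F (Set.range fun i => (x i : V)) = X ↔
      LinearIndependent F (fun (j : Fin (finrank F X)) (i : ι) => c.repr (x i) j) := by
    intro x
    let A : Matrix ι (Fin (finrank F X)) F := Matrix.of fun i j => c.repr (x i) j
    have h1 : finrank F (Submodule.span F (Set.range fun i => (x i : V))) = A.rank := by
      rw [Matrix.rank_eq_finrank_span_row]
      have e1 : Submodule.span F (Set.range fun i => (x i : V)) =
          (Submodule.span F (Set.range x)).map X.subtype := by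
        rw [Submodule.map_span, ← Set.range_comp]; rfl
      have e2 : Submodule.span F (Set.range A.row) =
          (Submodule.span F (Set.range x)).map
            (c.equivFun : X →ₗ[F] (Fin (finrank F X) → F)) := by
        rw [Submodule.map_span, ← Set.range_comp]; rfl
      rw [e1, e2, LinearEquiv.finrank_map_eq]
      exact X.finrank_map_subtype_eq _
    have hle : Submodule.span F (Set.range fun i => (x i : V)) ≤ X := by
      rw [Submodule.span_le]; rintro _ ⟨i, rfl⟩; exact (x i).2
    rw [linearIndependent_iff_card_eq_finrank_span, Fintype.card_fin]
    change _ ↔ _ = Set.finrank F (Set.range A.col)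
    rw [Set.finrank, ← Matrix.rank_eq_finrank_span_cols, ← h1]
    refine ⟨fun h => by rw [h], fun h => Submodule.eq_of_le_of_finrank_eq hle h.symm⟩
  have hmem : ∀ x : {x : ι → V // Submodule.span F (Set.range x) = X}, ∀ i, x.1 i ∈ X :=
    fun x i => x.2.le (Submodule.subset_span ⟨i, rfl⟩)
  let e : {x : ι → V // Submodule.span F (Set.range x) = X} ≃
      {s : Fin (finrank F X) → ι → F // LinearIndependent F s} :=
    { toFun := fun x => ⟨fun j i => c.repr ⟨x.1 i, hmem x i⟩ j, (hspan _).1 x.2⟩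
      invFun := fun s => ⟨fun i => (c.equivFun.symm fun j => s.1 j i : X), by
        rw [hspan (fun i => c.equivFun.symm fun j => s.1 j i)]
        convert! s.2 with j i
        exact congrFun (c.equivFun.apply_symm_apply fun j => s.1 j i) j⟩
      left_inv := fun x => by
        ext i
        exact congrArg Subtype.val (c.equivFun.symm_apply_apply ⟨x.1 i, hmem x i⟩)
      right_inv := fun s => by
        ext j i
        exact congrFun (c.equivFun.apply_symm_apply fun j => s.1 j i) j }
  exact Nat.card_congr e

theorem natCard_submodule_mul {F V : Type*} [Field F] [Finite F] [AddCommGroup V]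
    [Module F V] [Finite V] (d : ℕ) :
    Nat.card {W : Submodule F V // finrank F W = d} *
        ∏ i ∈ Finset.range d, (Nat.card F ^ d - Nat.card F ^ i) =
      ∏ i ∈ Finset.range d, (Nat.card F ^ finrank F V - Nat.card F ^ i) := by
  classical
  have hf : ∀ W : {W : Submodule F V // finrank F W = d},
      Nat.card {s : Fin d → V // LinearIndependent F s ∧ Submodule.span F (Set.range s) = W.1} =
        ∏ i ∈ Finset.range d, (Nat.card F ^ d - Nat.card F ^ i) := by
    intro W
    have h := natCard_span_range_eq (F := F) (ι := Fin d) W.1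
    rw [W.2, Fintype.card_fin] at h
    rw [← h]
    refine Nat.card_congr (Equiv.subtypeEquivRight fun s => ⟨And.right, fun hs => ⟨?_, hs⟩⟩)
    rw [linearIndependent_iff_card_eq_finrank_span, Set.finrank, hs, W.2, Fintype.card_fin]
  let e : {s : Fin d → V // LinearIndependent F s} ≃ Σ W : {W : Submodule F V // finrank F W = d},
      {s : Fin d → V // LinearIndependent F s ∧ Submodule.span F (Set.range s) = W.1} :=
    { toFun := fun s => ⟨⟨Submodule.span F (Set.range s.1), by
        rw [finrank_span_eq_card s.2, Fintype.card_fin]⟩, s.1, s.2, rfl⟩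
      invFun := fun s => ⟨s.2.1, s.2.2.1⟩
      left_inv := fun s => rfl
      right_inv := by
        rintro ⟨⟨W, hW⟩, s, hs, h⟩
        dsimp only at h
        subst h
        rfl }
  rw [← natCard_linearIndependent_fin, Nat.card_congr e, natCard_sigma_of_const hf]

theorem natCard_submodule_eq_gaussBinom {F V : Type*} [Field F] [Finite F] [AddCommGroup V]
    [Module F V] [Finite V] {d : ℕ} (hd : d ≤ finrank F V) :
    (Nat.card {W : Submodule F V // finrank F W = d} : ℚ) =
      gaussBinom (Nat.card F) (finrank F V) d := by
  have hq : 1 < Nat.card F := Finite.one_lt_card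
  have hq' : (1 : ℚ) < Nat.card F := by exact_mod_cast hq
  have key : ∀ n, d ≤ n → ((∏ i ∈ Finset.range d, (Nat.card F ^ n - Nat.card F ^ i) : ℕ) : ℚ) =
      ∏ i ∈ Finset.range d, ((Nat.card F : ℚ) ^ i * ((Nat.card F : ℚ) ^ (n - i) - 1)) := by
    intro n hn
    rw [Nat.cast_prod]
    refine Finset.prod_congr rfl fun i hi => ?_
    have hi : i ≤ n := (Finset.mem_range.1 hi).le.trans hn
    rw [Nat.cast_sub (Nat.pow_le_pow_right hq.le hi), mul_sub, ← pow_add, mul_one,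
      Nat.add_sub_cancel' hi]
    push_cast; rfl
  have h := congrArg (Nat.cast : ℕ → ℚ) (natCard_submodule_mul (F := F) (V := V) d)
  rw [Nat.cast_mul, key _ le_rfl, key _ hd] at h
  have hpos : ∏ i ∈ Finset.range d,
      ((Nat.card F : ℚ) ^ i * ((Nat.card F : ℚ) ^ (d - i) - 1)) ≠ 0 := by
    refine Finset.prod_ne_zero_iff.2 fun i hi => mul_ne_zero (by positivity) ?_
    have : 0 < d - i := Nat.sub_pos_of_lt (Finset.mem_range.1 hi)
    exact (sub_pos.2 (one_lt_pow₀ hq' this.ne')).ne'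
  rw [eq_div_of_mul_eq hpos h, gaussBinom, ← Finset.prod_div_distrib]
  refine Finset.prod_congr rfl fun i _ => ?_
  rw [mul_div_mul_left]
  positivity

/-! ### Intermediate fields of an extension of finite fields -/

section IntermediateFields

variable {K L : Type*} [Field K] [Field L] [Algebra K L] [Finite L]

/-- An intermediate field with `N` elements consists of the roots of `X ^ N - X`. -/
theorem IntermediateField.mem_iff_pow_natCard_eq (E : IntermediateField K L) (a : L) :
    a ∈ E ↔ a ^ Nat.card E = a := by
  classical
  have := Fintype.ofFinite L
  have := Fintype.ofFinite E
  have hE : ∀ a ∈ E, a ^ Nat.card E = a := by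
    intro a ha
    have := FiniteField.pow_card (⟨a, ha⟩ : E)
    rw [← Nat.card_eq_fintype_card] at this
    exact congrArg Subtype.val this
  refine ⟨hE a, fun ha => ?_⟩
  have h1 : 1 < Nat.card E := Finite.one_lt_card
  have hne := FiniteField.X_pow_card_sub_X_ne_zero L h1
  set f : Polynomial L := Polynomial.X ^ Nat.card E - Polynomial.X with hf
  have hroot : ∀ b, b ∈ f.roots.toFinset ↔ b ^ Nat.card E = b := by
    intro b
    rw [Multiset.mem_toFinset, Polynomial.mem_roots hne]
    simp [hf, sub_eq_zero]
  have hsub : (Finset.univ.filter (· ∈ E)) ⊆ f.roots.toFinset := by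
    intro b hb
    exact (hroot b).2 (hE b (Finset.mem_filter.1 hb).2)
  have hcard : f.roots.toFinset.card ≤ (Finset.univ.filter (· ∈ E)).card := by
    calc f.roots.toFinset.card ≤ f.natDegree :=
          (Multiset.toFinset_card_le _).trans f.card_roots'
      _ = Nat.card E := FiniteField.X_pow_card_sub_X_natDegree_eq L h1
      _ = _ := by rw [Nat.card_eq_fintype_card, Fintype.card_subtype]
  have := Finset.eq_of_subset_of_card_le hsub hcard
  exact (Finset.mem_filter.1 (this ▸ (hroot a).2 ha)).2

theorem IntermediateField.le_iff_finrank_dvd (F E : IntermediateField K L) :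
    F ≤ E ↔ finrank K F ∣ finrank K E := by
  have : Finite K := Finite.of_injective _ (algebraMap K L).injective
  refine ⟨fun h => IntermediateField.finrank_dvd_of_le_right h, ?_⟩
  rintro ⟨c, hc⟩ a ha
  rw [IntermediateField.mem_iff_pow_natCard_eq] at ha ⊢
  rw [natCard_eq_pow_finrank (K := K) (V := E), hc, pow_mul, ← natCard_eq_pow_finrank]
  clear hc
  induction c with
  | zero => simp
  | succ c ih => rw [pow_succ, pow_mul, ih, ha]

theorem IntermediateField.exists_finrank_eq {t : ℕ} (ht : t ∣ finrank K L) :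
    ∃ F : IntermediateField K L, finrank K F = t := by
  have : Finite K := Finite.of_injective _ (algebraMap K L).injective
  obtain ⟨p, hp⟩ := CharP.exists K
  have : Fact p.Prime := ⟨CharP.char_is_prime K p⟩
  have : NeZero t := ⟨(Nat.pos_of_dvd_of_pos ht finrank_pos).ne'⟩
  have hE := FiniteField.finrank_extension K p t
  obtain ⟨f⟩ := FiniteField.nonempty_algHom_of_finrank_dvd
    (F := K) (K := FiniteField.Extension K p t) (L := L) (by rwa [hE])
  exact ⟨f.fieldRange, (AlgEquiv.ofInjectiveField f).toLinearEquiv.finrank_eq.symm.trans hE⟩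

/-! ### Multipliers of a subspace of the extension field -/

/-- The multipliers of a `K`-subspace `X` of a finite field `L`: the elements `a` of `L` with
`a * X ⊆ X`. They form an intermediate field, whose nonzero elements are the stabilizer of `X`
under multiplication. -/
def multiplierField (X : Submodule K L) : IntermediateField K L where
  carrier := {a | ∀ x ∈ X, a * x ∈ X}
  mul_mem' := fun {a b} ha hb x hx => by rw [mul_assoc]; exact ha _ (hb _ hx)
  one_mem' := fun x hx => by rwa [one_mul]
  add_mem' := fun {a b} ha hb x hx => by rw [add_mul]; exact X.add_mem (ha _ hx) (hb _ hx)
  zero_mem' := fun x hx => by rw [zero_mul]; exact X.zero_mem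
  algebraMap_mem' := fun c x hx => by rw [← Algebra.smul_def]; exact X.smul_mem c hx
  inv_mem' := by
    intro a ha x hx
    rcases eq_or_ne a 0 with rfl | h0
    · simp
    -- The inverse is a power of `a`, because `L` is finite.
    have hpow : ∀ n : ℕ, ∀ x ∈ X, a ^ n * x ∈ X := by
      intro n
      induction n with
      | zero => intro x hx; simpa
      | succ n ih => intro x hx; rw [pow_succ, mul_assoc]; exact ih _ (ha _ hx)
    have := Fintype.ofFinite L
    have h1 : a⁻¹ = a ^ (Fintype.card L - 2) := by
      refine inv_eq_of_mul_eq_one_right ?_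
      have h2 : 1 < Fintype.card L := Fintype.one_lt_card
      rw [← pow_succ', show Fintype.card L - 2 + 1 = Fintype.card L - 1 by omega]
      exact FiniteField.pow_card_sub_one_eq_one a h0
    rw [h1]
    exact hpow _ x hx

theorem mem_multiplierField {X : Submodule K L} {a : L} :
    a ∈ multiplierField X ↔ ∀ x ∈ X, a * x ∈ X := Iff.rfl

/-- The subspaces whose multipliers include a given intermediate field `F` are the `F`-subspaces. -/
def submoduleEquivOfLeMultiplierField (F : IntermediateField K L) :
    {X : Submodule K L // F ≤ multiplierField X} ≃ Submodule F L where
  toFun X :=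
    { X.1 with smul_mem' := fun a _ hx => X.2 a.2 _ hx }
  invFun W := ⟨W.restrictScalars K, fun a ha _ hx => W.smul_mem (⟨a, ha⟩ : F) hx⟩
  left_inv _ := rfl
  right_inv _ := rfl

theorem finrank_mul_finrank_submoduleEquiv (F : IntermediateField K L)
    (X : {X : Submodule K L // F ≤ multiplierField X}) :
    finrank K F * finrank F (submoduleEquivOfLeMultiplierField F X) = finrank K X.1 :=
  finrank_mul_finrank K F (submoduleEquivOfLeMultiplierField F X)

theorem finrank_multiplierField_dvd_gcd (X : Submodule K L) :
    finrank K (multiplierField X) ∣ Nat.gcd (finrank K X) (finrank K L) :=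
  Nat.dvd_gcd
    (Dvd.intro _ (finrank_mul_finrank_submoduleEquiv (multiplierField X) ⟨X, le_rfl⟩))
    (Dvd.intro _ (finrank_mul_finrank K (multiplierField X) L))

theorem natCard_finrank_le_multiplierField (F : IntermediateField K L) {d : ℕ}
    (hd : d ≤ finrank K L) (hF : finrank K F ∣ d) :
    (Nat.card {X : Submodule K L // finrank K X = d ∧ F ≤ multiplierField X} : ℚ) =
      gaussBinom (Nat.card K ^ finrank K F) (finrank K L / finrank K F)
        (d / finrank K F) := by
  have : Finite K := Finite.of_injective _ (algebraMap K L).injective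
  have hpos : 0 < finrank K F := finrank_pos
  have hL : finrank K L / finrank K F = finrank F L :=
    Nat.div_eq_of_eq_mul_right hpos (finrank_mul_finrank K F L).symm
  have hle : d / finrank K F ≤ finrank F L := hL ▸ Nat.div_le_div_right hd
  rw [hL, ← natCard_eq_pow_finrank, ← natCard_submodule_eq_gaussBinom hle]
  congr 1
  have e : {X : Submodule K L // finrank K X = d ∧ F ≤ multiplierField X} ≃
      {Y : {X : Submodule K L // F ≤ multiplierField X} // finrank K Y.1 = d} :=
    { toFun := fun X => ⟨⟨X.1, X.2.2⟩, X.2.1⟩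
      invFun := fun Y => ⟨Y.1.1, Y.2, Y.1.2⟩
      left_inv := fun _ => rfl
      right_inv := fun _ => rfl }
  refine Nat.card_congr (e.trans ((submoduleEquivOfLeMultiplierField F).subtypeEquiv fun Y => ?_))
  rw [← finrank_mul_finrank_submoduleEquiv F Y, eq_comm, ← Nat.div_eq_iff_eq_mul_right hpos hF,
    eq_comm]

/-- The defining property of the Möbius function, for the interval between `u` and `e` in the
lattice of divisors of `g`. -/
theorem sum_moebius_div_filter_dvd {g u e : ℕ} (hg : g ≠ 0) (he : e ∣ g) (hu : u ∣ g) :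
    (∑ t ∈ g.divisors with u ∣ t,
      if t ∣ e then (ArithmeticFunction.moebius (t / u) : ℚ) else 0) = if e = u then 1 else 0 := by
  have hu0 : 0 < u := Nat.pos_of_dvd_of_pos hu (Nat.pos_of_ne_zero hg)
  rw [← Finset.sum_filter, Finset.filter_filter]
  by_cases hue : u ∣ e
  · obtain ⟨c, rfl⟩ := hue
    have hc : c ≠ 0 := by rintro rfl; simp at he; exact hg he
    have hset : g.divisors.filter (fun t => u ∣ t ∧ t ∣ u * c) = c.divisors.image (u * ·) := by
      ext t
      simp only [Finset.mem_filter, Nat.mem_divisors, Finset.mem_image]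
      constructor
      · rintro ⟨-, ⟨s, rfl⟩, h⟩
        exact ⟨s, ⟨Nat.dvd_of_mul_dvd_mul_left hu0 h, hc⟩, rfl⟩
      · rintro ⟨s, ⟨h, -⟩, rfl⟩
        exact ⟨⟨(Nat.mul_dvd_mul_left u h).trans he, hg⟩, dvd_mul_right _ _,
          Nat.mul_dvd_mul_left u h⟩
    rw [hset, Finset.sum_image fun a _ b _ h => Nat.eq_of_mul_eq_mul_left hu0 h]
    simp only [Nat.mul_div_cancel_left _ hu0]
    have h1 := congrArg (fun f : ArithmeticFunction ℤ => f c)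
      ArithmeticFunction.moebius_mul_coe_zeta
    simp only [ArithmeticFunction.coe_mul_zeta_apply, ArithmeticFunction.one_apply] at h1
    have h2 : u * c = u ↔ c = 1 := by
      conv_lhs => rw [← mul_one u, mul_assoc, one_mul]
      exact Nat.mul_right_inj hu0.ne'
    rw [← Int.cast_sum, h1]
    simp [h2]
  · rw [if_neg (by rintro rfl; exact hue dvd_rfl)]
    refine Finset.sum_eq_zero fun t ht => ?_
    exact absurd ((Finset.mem_filter.1 ht).2.1.trans (Finset.mem_filter.1 ht).2.2) hue

/-- Möbius inversion over the lattice of intermediate fields, which is the lattice of divisors of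
the degree: the `d`-dimensional subspaces with multiplier field of degree exactly `u` are counted
through those with multiplier field of degree a multiple of `t`, that is, through the subspaces
over the intermediate field of degree `t`. -/
theorem natCard_finrank_multiplierField_eq {d u : ℕ} (hd : d ≤ finrank K L)
    (hu : u ∣ Nat.gcd d (finrank K L)) :
    (Nat.card {X : Submodule K L // finrank K X = d ∧ finrank K (multiplierField X) = u} : ℚ) =
      ∑ t ∈ (Nat.gcd d (finrank K L)).divisors with u ∣ t,
        (ArithmeticFunction.moebius (t / u) : ℚ) *
          gaussBinom (Nat.card K ^ t) (finrank K L / t) (d / t) := by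
  classical
  have := Fintype.ofFinite (Submodule K L)
  have hg : Nat.gcd d (finrank K L) ≠ 0 :=
    (Nat.gcd_pos_of_pos_right _ (finrank_pos (R := K) (M := L))).ne'
  let S : Finset (Submodule K L) := Finset.univ.filter fun X : Submodule K L => finrank K X = d
  have hgauss : ∀ t ∈ (Nat.gcd d (finrank K L)).divisors,
      gaussBinom (Nat.card K ^ t) (finrank K L / t) (d / t) =
        ∑ X ∈ S,
          if t ∣ finrank K (multiplierField X) then (1 : ℚ) else 0 := by
    intro t ht
    have ht := Nat.dvd_of_mem_divisors ht
    obtain ⟨F, rfl⟩ := IntermediateField.exists_finrank_eq (K := K) (L := L)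
      (ht.trans (Nat.gcd_dvd_right _ _))
    rw [← natCard_finrank_le_multiplierField F hd (ht.trans (Nat.gcd_dvd_left _ _)),
      Nat.card_eq_fintype_card, Fintype.card_subtype, Finset.sum_boole, Finset.filter_filter]
    simp only [IntermediateField.le_iff_finrank_dvd]
  calc (Nat.card {X : Submodule K L //
        finrank K X = d ∧ finrank K (multiplierField X) = u} : ℚ)
      = ∑ X ∈ S,
          if finrank K (multiplierField X) = u then (1 : ℚ) else 0 := by
        rw [Nat.card_eq_fintype_card, Fintype.card_subtype, Finset.sum_boole, Finset.filter_filter]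
    _ = ∑ X ∈ S,
          ∑ t ∈ (Nat.gcd d (finrank K L)).divisors with u ∣ t,
            if t ∣ finrank K (multiplierField X) then
              (ArithmeticFunction.moebius (t / u) : ℚ) else 0 := by
        refine Finset.sum_congr rfl fun X hX => ?_
        rw [sum_moebius_div_filter_dvd hg _ hu]
        have := finrank_multiplierField_dvd_gcd X
        rwa [(Finset.mem_filter.1 hX).2] at this
    _ = _ := by
        rw [Finset.sum_comm]
        refine Finset.sum_congr rfl fun t ht => ?_
        rw [hgauss t (Finset.mem_filter.1 ht).1, Finset.mul_sum]
        simp only [mul_ite, mul_one, mul_zero]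

/-! ### Families of subspaces invariant under multiplication -/

open Pointwise

omit [Finite L] in
theorem mem_units_smul_submodule {a : Lˣ} {X : Submodule K L} {y : L} :
    y ∈ a • X ↔ ∃ x ∈ X, (a : L) * x = y :=
  Iff.rfl

theorem multiplierField_smul (a : Lˣ) (X : Submodule K L) :
    multiplierField (a • X) = multiplierField X := by
  ext c
  simp only [mem_multiplierField, mem_units_smul_submodule]
  constructor
  · intro h x hx
    obtain ⟨y, hy, hxy⟩ := h _ ⟨x, hx, rfl⟩
    rw [mul_left_comm] at hxy
    rwa [← mul_left_cancel₀ a.ne_zero hxy]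
  · rintro h _ ⟨y, hy, rfl⟩
    exact ⟨c * y, h y hy, mul_left_comm _ _ _⟩

omit [Finite L] in
theorem finrank_units_smul (a : Lˣ) (X : Submodule K L) :
    finrank K (a • X : Submodule K L) = finrank K X :=
  LinearEquiv.finrank_map_eq (DistribMulAction.toLinearEquiv K L a) X

/-- The orbit-stabilizer theorem, for the multiplication of subspaces of `L` by units. -/
theorem ncard_orbit_units_mul (X : Submodule K L) :
    (MulAction.orbit Lˣ X).ncard * (Nat.card K ^ finrank K (multiplierField X) - 1) =
      Nat.card K ^ finrank K L - 1 := by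
  classical
  have : Finite K := Finite.of_injective _ (algebraMap K L).injective
  have hmem : ∀ a : Lˣ, a ∈ MulAction.stabilizer Lˣ X ↔ (a : L) ∈ multiplierField X := by
    intro a
    rw [MulAction.mem_stabilizer_iff, mem_multiplierField]
    constructor
    · intro h x hx
      have : (a : L) * x ∈ a • X := ⟨x, hx, rfl⟩
      rwa [h] at this
    · intro h
      refine Submodule.eq_of_le_of_finrank_eq ?_ (finrank_units_smul a X)
      rintro _ ⟨x, hx, rfl⟩
      exact h x hx
  have e : MulAction.stabilizer Lˣ X ≃ (multiplierField X)ˣ :=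
    { toFun := fun a => Units.mk0 ⟨a.1, (hmem _).1 a.2⟩ fun h =>
        a.1.ne_zero (congrArg Subtype.val h)
      invFun := fun a => ⟨Units.mk0 (a : multiplierField X) fun h =>
        a.ne_zero (Subtype.ext h), (hmem _).2 (a : multiplierField X).2⟩
      left_inv := fun a => by ext; rfl
      right_inv := fun a => by ext; rfl }
  have := Fintype.ofFinite Lˣ
  have := Fintype.ofFinite (MulAction.stabilizer Lˣ X)
  have := Fintype.ofFinite (MulAction.orbit Lˣ X)
  have h := MulAction.card_orbit_mul_card_stabilizer_eq_card_group Lˣ X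
  rwa [← Nat.card_eq_fintype_card, ← Nat.card_eq_fintype_card, ← Nat.card_eq_fintype_card,
    Nat.card_congr e, Nat.card_units, Nat.card_units, Nat.card_coe_set_eq,
    natCard_eq_pow_finrank (K := K), natCard_eq_pow_finrank (K := K) (V := L)] at h

/-- Invariant families of every size allowed by the number of orbits: all subspaces with the same
dimension and the same multiplier degree have orbits of the same size, and orbits can be added
one at a time. -/
theorem exists_invariant_family {d u w : ℕ} (hd : d ≤ finrank K L)
    (hu : u ∣ Nat.gcd d (finrank K L))
    (hw : (w : ℚ) ≤ singerOrbitNumber (Nat.card K) (finrank K L) d u) :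
    ∃ 𝒳 : Set (Submodule K L),
      (∀ X ∈ 𝒳, finrank K X = d ∧ finrank K (multiplierField X) = u) ∧
      (∀ a : Lˣ, ∀ X ∈ 𝒳, a • X ∈ 𝒳) ∧
      𝒳.ncard * (Nat.card K ^ u - 1) = w * (Nat.card K ^ finrank K L - 1) := by
  have : Finite K := Finite.of_injective _ (algebraMap K L).injective
  have hq : 1 < Nat.card K := Finite.one_lt_card
  have hlpos : 0 < finrank K L := finrank_pos
  have hu0 : u ≠ 0 := by
    rintro rfl
    exact (Nat.gcd_pos_of_pos_right d hlpos).ne' (Nat.eq_zero_of_zero_dvd hu)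
  have hL1 : 0 < Nat.card K ^ finrank K L - 1 := Nat.sub_pos_of_lt (Nat.one_lt_pow hlpos.ne' hq)
  have hU1 : 0 < Nat.card K ^ u - 1 := Nat.sub_pos_of_lt (Nat.one_lt_pow hu0 hq)
  set 𝒜 : Set (Submodule K L) :=
    {X | finrank K X = d ∧ finrank K (multiplierField X) = u} with h𝒜
  have hw' : w * (Nat.card K ^ finrank K L - 1) ≤ 𝒜.ncard * (Nat.card K ^ u - 1) := by
    rw [singerOrbitNumber, ← natCard_finrank_multiplierField_eq hd hu] at hw
    have hc : ∀ n, ((Nat.card K ^ n - 1 : ℕ) : ℚ) = (Nat.card K : ℚ) ^ n - 1 := fun n => by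
      rw [Nat.cast_sub (Nat.one_le_pow _ _ (by omega))]; push_cast; rfl
    rw [← hc, ← hc, div_mul_eq_mul_div, le_div_iff₀ (by exact_mod_cast hL1)] at hw
    rw [mul_comm 𝒜.ncard]
    exact_mod_cast hw
  clear hw
  induction w with
  | zero => exact ⟨∅, by simp, by simp, by simp⟩
  | succ w ih =>
    rw [add_mul, one_mul] at hw'
    obtain ⟨𝒳, h1, h2, h3⟩ := ih (by omega)
    have hss : 𝒳 ⊂ 𝒜 := by
      refine (Set.ssubset_iff_subset_ne).2 ⟨h1, fun h => ?_⟩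
      rw [h] at h3
      omega
    -- An orbit that meets the complement of the invariant set `𝒳` is disjoint from `𝒳`.
    obtain ⟨X, hX, hX'⟩ := Set.exists_of_ssubset hss
    refine ⟨𝒳 ∪ MulAction.orbit Lˣ X, ?_, ?_, ?_⟩
    · rintro Y (hY | ⟨a, rfl⟩)
      · exact h1 Y hY
      · exact ⟨(finrank_units_smul a X).trans hX.1, (multiplierField_smul a X) ▸ hX.2⟩
    · rintro a Y (hY | ⟨b, rfl⟩)
      · exact Or.inl (h2 a Y hY)
      · exact Or.inr ⟨a * b, mul_smul a b X⟩
    · have hdisj : Disjoint 𝒳 (MulAction.orbit Lˣ X) := by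
        rw [Set.disjoint_left]
        rintro Y hY ⟨a, rfl⟩
        exact hX' (by simpa using h2 a⁻¹ _ hY)
      have horb := ncard_orbit_units_mul X
      rw [hX.2] at horb
      rw [Set.ncard_union_eq hdisj (Set.toFinite _) (Set.toFinite _), add_mul, h3, horb, add_mul,
        one_mul]

/-- The union of invariant families for several pairs of a dimension and a multiplier degree. The
sum over it of a function `f` of the dimension weighs `f (d i)` with the size of the `i`-th family,
which is `w i` times the size of an orbit. -/
theorem exists_invariant_union {ι : Type*} {I : Finset ι} {d u w : ι → ℕ}
    (hinj : Set.InjOn (fun i => (d i, u i)) I) (hd : ∀ i ∈ I, d i ≤ finrank K L)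
    (hu : ∀ i ∈ I, u i ∣ Nat.gcd (d i) (finrank K L))
    (hw : ∀ i ∈ I, (w i : ℚ) ≤ singerOrbitNumber (Nat.card K) (finrank K L) (d i) (u i)) :
    ∃ 𝒳 : Finset (Submodule K L),
      (∀ X ∈ 𝒳, ∃ i ∈ I, finrank K X = d i) ∧
      (∀ a : Lˣ, ∀ X ∈ 𝒳, a • X ∈ 𝒳) ∧
      ∀ f : ℕ → ℚ, ∑ X ∈ 𝒳, f (finrank K X) =
        ∑ i ∈ I, w i * (((Nat.card K : ℚ) ^ finrank K L - 1) / ((Nat.card K : ℚ) ^ u i - 1)) *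
          f (d i) := by
  classical
  have : Finite K := Finite.of_injective _ (algebraMap K L).injective
  have hq : 1 < Nat.card K := Finite.one_lt_card
  have hq' : (1 : ℚ) < Nat.card K := by exact_mod_cast hq
  choose! F hF1 hF2 hF3 using fun i hi => exists_invariant_family (hd i hi) (hu i hi) (hw i hi)
  refine ⟨I.biUnion fun i => (Set.toFinite (F i)).toFinset, ?_, ?_, ?_⟩
  · intro X hX
    obtain ⟨i, hi, hX⟩ := Finset.mem_biUnion.1 hX
    exact ⟨i, hi, (hF1 i hi X ((Set.toFinite (F i)).mem_toFinset.1 hX)).1⟩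
  · intro a X hX
    obtain ⟨i, hi, hX⟩ := Finset.mem_biUnion.1 hX
    exact Finset.mem_biUnion.2 ⟨i, hi, (Set.toFinite (F i)).mem_toFinset.2
      (hF2 i hi a X ((Set.toFinite (F i)).mem_toFinset.1 hX))⟩
  · intro f
    rw [Finset.sum_biUnion]
    · refine Finset.sum_congr rfl fun i hi => ?_
      have hconst : ∀ X ∈ (Set.toFinite (F i)).toFinset, f (finrank K X) = f (d i) := fun X hX => by
        rw [(hF1 i hi X ((Set.toFinite (F i)).mem_toFinset.1 hX)).1]
      rw [Finset.sum_congr rfl hconst, Finset.sum_const, nsmul_eq_mul,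
        ← Set.ncard_eq_toFinset_card]
      congr 1
      have hu0 : u i ≠ 0 := by
        intro h0
        have := hu i hi
        rw [h0, zero_dvd_iff] at this
        exact (Nat.gcd_pos_of_pos_right _ (finrank_pos (R := K) (M := L))).ne' this
      have hc : ∀ n, ((Nat.card K ^ n - 1 : ℕ) : ℚ) = (Nat.card K : ℚ) ^ n - 1 := fun n => by
        rw [Nat.cast_sub (Nat.one_le_pow _ _ (by omega))]; push_cast; rfl
      rw [← mul_div_assoc, eq_div_iff (sub_pos.2 (one_lt_pow₀ hq' hu0)).ne', ← hc, ← hc]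
      exact_mod_cast hF3 i hi
    · intro i hi j hj hij
      rw [Function.onFun, Finset.disjoint_left]
      intro X hXi hXj
      have h1 := hF1 i hi X ((Set.toFinite (F i)).mem_toFinset.1 hXi)
      have h2 := hF1 j hj X ((Set.toFinite (F j)).mem_toFinset.1 hXj)
      exact hij (hinj hi hj (Prod.ext (h1.1.symm.trans h2.1) (h1.2.symm.trans h2.2)))

end IntermediateFields

/-! ### From a class of tuples to a design -/

/-- The number of extensions of two independent vectors of `S` to a basis of `S`. -/
theorem natCard_linearIndependent_span_eq {K V : Type*} [Field K] [Finite K] [AddCommGroup V]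
    [Module K V] [Finite V] {n : ℕ} {p : Fin 2 → V} (hp : LinearIndependent K p)
    {S : Submodule K V} (hS : finrank K S = 2 + n) (hpS : ∀ i, p i ∈ S) :
    Nat.card {s : Fin n → V // LinearIndependent K (Sum.elim p s) ∧
        Submodule.span K (Set.range (Sum.elim p s)) = S} =
      ∏ i ∈ Finset.range n, (Nat.card K ^ (2 + n) - Nat.card K ^ (2 + i)) := by
  have hp' : LinearIndependent K fun i => (⟨p i, hpS i⟩ : S) :=
    LinearIndependent.of_comp S.subtype hp
  have h := natCard_linearIndependent_sumElim hp' n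
  rw [hS, Fintype.card_fin] at h
  rw [← h]
  have hsub : ∀ s : Fin n → S, (Sum.elim p fun j => (s j : V)) =
      S.subtype ∘ Sum.elim (fun i => (⟨p i, hpS i⟩ : S)) s := by
    intro s
    funext i
    rcases i with i | i <;> rfl
  have e : {s : Fin n → V // LinearIndependent K (Sum.elim p s) ∧
        Submodule.span K (Set.range (Sum.elim p s)) = S} ≃
      {s : Fin n → S // LinearIndependent K (Sum.elim (fun i => (⟨p i, hpS i⟩ : S)) s)} :=
    { toFun := fun s => ⟨fun j => ⟨s.1 j, s.2.2.le (Submodule.subset_span ⟨Sum.inr j, rfl⟩)⟩,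
        LinearIndependent.of_comp S.subtype (by rw [← hsub]; exact s.2.1)⟩
      invFun := fun s => ⟨fun j => s.1 j, by
        have hli : LinearIndependent K (Sum.elim p fun j => (s.1 j : V)) := by
          rw [hsub]
          exact s.2.map' S.subtype S.ker_subtype
        refine ⟨hli, Submodule.eq_of_le_of_finrank_eq ?_ ?_⟩
        · rw [Submodule.span_le]
          rintro _ ⟨i | i, rfl⟩
          · exact hpS i
          · exact (s.1 i).2
        · rw [finrank_span_eq_card hli, hS]; simp⟩
      left_inv := fun s => rfl
      right_inv := fun s => rfl }
  exact Nat.card_congr e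

/-- The `K`-subspaces spanned by the tuples that satisfy `P`. -/
def spansOf (K : Type*) {V ι : Type*} [Field K] [AddCommGroup V] [Module K V]
    (P : (ι → V) → Prop) : Set (Submodule K V) :=
  {S | ∃ b, P b ∧ Submodule.span K (Set.range b) = S}

section TupleClass

variable {K L V : Type*} [Field K] [Finite K] [Field L] [Algebra K L]
    [AddCommGroup V] [Module K V] [Module L V] [IsScalarTower K L V] [Finite V]

/-- A class of tuples whose spans are the blocks of a design: a block has all its bases in the
class, and the first two entries of a tuple of the class are independent even over `L`. Since
any two independent vectors of a block are the first two entries of some basis, this makes the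
block meet every `1`-dimensional `L`-subspace in dimension at most one. -/
structure IsBlockClass (K L : Type*) {V : Type*} [Field K] [Field L]
    [AddCommGroup V] [Module K V] [Module L V] {n : ℕ}
    (P : (Fin 2 ⊕ Fin n → V) → Prop) : Prop where
  linearIndependent : ∀ b, P b → LinearIndependent K b
  linearIndependent_pair : ∀ b, P b → LinearIndependent L (b ∘ Sum.inl)
  of_span_eq : ∀ b b', P b → LinearIndependent K b' →
    Submodule.span K (Set.range b') = Submodule.span K (Set.range b) → P b'
  map : ∀ b, P b → ∀ g : V ≃ₗ[L] V, P (g ∘ b)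

omit [Algebra K L] [IsScalarTower K L V] in
/-- Double counting: a tuple of the class that extends a fixed basis of `T` is a block through `T`
together with an extension of that basis to a basis of the block. -/
theorem IsBlockClass.ncard_mul {n : ℕ} {P : (Fin 2 ⊕ Fin n → V) → Prop} (hP : IsBlockClass K L P)
    {p : Fin 2 → V} (hp : LinearIndependent K p) :
    {S | S ∈ spansOf K P ∧ Submodule.span K (Set.range p) ≤ S}.ncard *
        ∏ i ∈ Finset.range n, (Nat.card K ^ (2 + n) - Nat.card K ^ (2 + i)) =
      Nat.card {s : Fin n → V // P (Sum.elim p s)} := by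
  have hmem : ∀ S : {S | S ∈ spansOf K P ∧ Submodule.span K (Set.range p) ≤ S},
      ∀ i, p i ∈ S.1 := fun S i => S.2.2 (Submodule.subset_span ⟨i, rfl⟩)
  have hfr : ∀ S ∈ spansOf K P, finrank K S = 2 + n := by
    rintro _ ⟨b, hb, rfl⟩
    rw [finrank_span_eq_card (hP.linearIndependent b hb)]
    simp
  have hf := fun S : {S | S ∈ spansOf K P ∧ Submodule.span K (Set.range p) ≤ S} =>
    natCard_linearIndependent_span_eq hp (hfr S.1 S.2.1) (hmem S)
  have e : {s : Fin n → V // P (Sum.elim p s)} ≃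
      Σ S : {S | S ∈ spansOf K P ∧ Submodule.span K (Set.range p) ≤ S},
        {s : Fin n → V // LinearIndependent K (Sum.elim p s) ∧
          Submodule.span K (Set.range (Sum.elim p s)) = S.1} :=
    { toFun := fun s => ⟨⟨Submodule.span K (Set.range (Sum.elim p s.1)), ⟨_, s.2, rfl⟩,
          Submodule.span_mono (by rintro _ ⟨i, rfl⟩; exact ⟨Sum.inl i, rfl⟩)⟩,
        s.1, hP.linearIndependent _ s.2, rfl⟩
      invFun := fun s => ⟨s.2.1, by
        obtain ⟨b, hb, hbS⟩ := s.1.2.1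
        exact hP.of_span_eq b _ hb s.2.2.1 (s.2.2.2.trans hbS.symm)⟩
      left_inv := fun s => rfl
      right_inv := by
        rintro ⟨⟨S, hS⟩, s, hs, h⟩
        dsimp only at h
        subst h
        rfl }
  rw [Nat.card_congr e, natCard_sigma_of_const hf, Nat.card_coe_set_eq]

omit [Finite K] [Finite V] in
theorem exists_desarguesianSpread_of_not_linearIndependent {p : Fin 2 → V}
    (hp : LinearIndependent K p) (h : ¬ LinearIndependent L p) :
    ∃ G ∈ desarguesianSpread K L V, Submodule.span K (Set.range p) ≤ G := by
  rw [linearIndependent_iff_card_le_finrank_span, Fintype.card_fin, Set.finrank] at h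
  have : FiniteDimensional L (Submodule.span L (Set.range p)) :=
    FiniteDimensional.span_of_finite L (Set.finite_range p)
  refine ⟨_, ⟨Submodule.span L (Set.range p), ?_, rfl⟩, Submodule.span_le_restrictScalars K L _⟩
  have hne : Submodule.span L (Set.range p) ≠ ⊥ := by
    intro hbot
    rw [Submodule.span_eq_bot] at hbot
    exact hp.ne_zero 0 (hbot _ ⟨0, rfl⟩)
  have := (Submodule.one_le_finrank_iff).2 hne
  omega

omit [Finite K] in
/-- The Desarguesian spread is a partition of the points. -/
theorem existsUnique_desarguesianSpread {P : Submodule K V} (hP : finrank K P = 1) :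
    ∃! G, G ∈ desarguesianSpread K L V ∧ P ≤ G := by
  obtain ⟨v, hv0, hv⟩ := finrank_eq_one_iff'.1 hP
  have hv0' : (v : V) ≠ 0 := fun h => hv0 (Subtype.ext h)
  refine ⟨(Submodule.span L {(v : V)}).restrictScalars K,
    ⟨⟨_, finrank_span_singleton hv0', rfl⟩, ?_⟩, ?_⟩
  · intro x hx
    obtain ⟨c, hc⟩ := hv ⟨x, hx⟩
    have : x = c • (v : V) := (congrArg Subtype.val hc).symm
    rw [this]
    exact Submodule.smul_mem _ c (Submodule.mem_span_singleton_self (v : V))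
  · rintro _ ⟨⟨W, hW, rfl⟩, hPW⟩
    have hvW : (v : V) ∈ W := hPW v.2
    have := Module.finite_of_finrank_pos (R := L) (M := W) (by omega)
    rw [Submodule.eq_of_le_of_finrank_eq
      ((Submodule.span_singleton_le_iff_mem _ _).2 hvW) (by rw [hW, finrank_span_singleton hv0'])]

theorem IsBlockClass.isQGDD {n lam : ℕ} {P : (Fin 2 ⊕ Fin n → V) → Prop}
    (hP : IsBlockClass K L P) {B : Multiset (Submodule K V)} (hnd : B.Nodup)
    (hB : ∀ S, S ∈ B ↔ S ∈ spansOf K P)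
    (hlam : ∀ p : Fin 2 → V, LinearIndependent L p →
      {S | S ∈ spansOf K P ∧ Submodule.span K (Set.range p) ≤ S}.ncard = lam) :
    IsQGDD (finrank L V * finrank K L) (finrank K L) (2 + n) lam
      (desarguesianSpread K L V) B where
  finiteDimensional := Module.Finite.of_finite
  finrank_space := by rw [mul_comm, finrank_mul_finrank]
  finrank_group := by
    rintro _ ⟨W, hW, rfl⟩
    have := finrank_mul_finrank K L W
    rw [hW, mul_one] at this
    exact this.symm
  existsUnique_group P hP := existsUnique_desarguesianSpread hP
  finrank_block := by
    intro S hS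
    obtain ⟨b, hb, rfl⟩ := (hB S).1 hS
    rw [finrank_span_eq_card (hP.linearIndependent b hb)]
    simp
  finrank_block_inf_group := by
    rintro S hS _ ⟨W, hW, rfl⟩
    by_contra! hlt
    obtain ⟨b, hb, rfl⟩ := (hB S).1 hS
    set I := Submodule.span K (Set.range b) ⊓ W.restrictScalars K
    have hfr : finrank K (Submodule.span K (Set.range b)) = 2 + n := by
      rw [finrank_span_eq_card (hP.linearIndependent b hb)]
      simp
    -- Two independent vectors of the intersection start a basis of the block, so they are
    -- independent over `L`, but they lie in a line over `L`.
    obtain ⟨f, hf⟩ := exists_linearIndependent_of_le_finrank (R := K) (M := I) hlt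
    have hp : LinearIndependent K fun i => (f i : V) := hf.map' I.subtype I.ker_subtype
    have hcard := natCard_linearIndependent_span_eq hp hfr fun i => (f i).2.1
    have hpos : 0 < ∏ i ∈ Finset.range n, (Nat.card K ^ (2 + n) - Nat.card K ^ (2 + i)) :=
      Finset.prod_pos fun i hi => Nat.sub_pos_of_lt
        (Nat.pow_lt_pow_right Finite.one_lt_card (by simpa using hi))
    rw [← hcard] at hpos
    obtain ⟨s, hs, hsp⟩ := (Nat.card_pos_iff.1 hpos).1.some
    have hL := hP.linearIndependent_pair _ (hP.of_span_eq b _ hb hs hsp)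
    have hLW : LinearIndependent L fun i => (⟨(f i : V), (f i).2.2⟩ : W) :=
      LinearIndependent.of_comp W.subtype hL
    have := Module.finite_of_finrank_pos (R := L) (M := W) (by omega)
    have := hLW.fintype_card_le_finrank
    rw [hW, Fintype.card_fin] at this
    omega
  card_blocks := by
    classical
    intro T hT hTG
    let c := finBasisOfFinrankEq K T hT
    have hp : LinearIndependent K fun i => (c i : V) :=
      c.linearIndependent.map' T.subtype T.ker_subtype
    have hspan : Submodule.span K (Set.range fun i => (c i : V)) = T := by
      have := c.span_eq
      have h2 := congrArg (Submodule.map T.subtype) this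
      rwa [Submodule.map_span, ← Set.range_comp, Submodule.map_top, Submodule.range_subtype] at h2
    have hpL : LinearIndependent L fun i => (c i : V) := by
      by_contra h
      obtain ⟨G, hG, hle⟩ := exists_desarguesianSpread_of_not_linearIndependent hp h
      exact hTG G hG (hspan ▸ hle)
    rw [← hlam _ hpL, hspan]
    have hset : {S | S ∈ spansOf K P ∧ T ≤ S} =
        ((⟨B, hnd⟩ : Finset (Submodule K V)).filter (T ≤ ·) : Finset (Submodule K V)) := by
      ext S
      simp [hB]
    rw [hset, Set.ncard_coe_finset, Finset.card_def, Finset.filter_val]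

omit [Finite K] [Finite V] in
theorem isGDDAutomorphism_of_map_mem {B : Multiset (Submodule K V)} (hnd : B.Nodup)
    (hB : ∀ g : V ≃ₗ[L] V, ∀ S ∈ B, S.map (g.restrictScalars K : V →ₗ[K] V) ∈ B)
    (g : V ≃ₗ[L] V) :
    IsGDDAutomorphism (desarguesianSpread K L V) B (g.restrictScalars K) := by
  have hinv : ∀ S : Submodule K V, (S.map (g.symm.restrictScalars K : V →ₗ[K] V)).map
      (g.restrictScalars K : V →ₗ[K] V) = S := by
    intro S
    rw [← Submodule.map_comp]
    convert Submodule.map_id S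
    ext v
    simp
  constructor
  · have hG : ∀ g : V ≃ₗ[L] V, ∀ S ∈ desarguesianSpread K L V,
        S.map (g.restrictScalars K : V →ₗ[K] V) ∈ desarguesianSpread K L V := by
      rintro g _ ⟨W, hW, rfl⟩
      exact ⟨W.map (g : V →ₗ[L] V), (LinearEquiv.finrank_map_eq g W).trans hW, rfl⟩
    refine Set.Subset.antisymm ?_ fun S hS => ⟨_, hG g.symm S hS, hinv S⟩
    rintro _ ⟨S, hS, rfl⟩
    exact hG g S hS
  · have hinj : Function.Injective fun S : Submodule K V =>
        S.map ((g.restrictScalars K : V ≃ₗ[K] V) : V →ₗ[K] V) :=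
      Submodule.map_injective_of_injective (g.restrictScalars K).injective
    refine (Multiset.Nodup.ext (hnd.map hinj) hnd).2 fun S => ?_
    rw [Multiset.mem_map]
    constructor
    · rintro ⟨S, hS, rfl⟩
      exact hB g S hS
    · exact fun hS => ⟨_, hB g.symm S hS, hinv S⟩

end TupleClass

/-! ### Tuples with prescribed linear relations -/

/-- The `L`-linear relations satisfied by a tuple of vectors. -/
def relations (L : Type*) {V ι : Type*} [Field L] [AddCommGroup V] [Module L V] [Fintype ι]
    (b : ι → V) : Submodule L (ι → L) :=
  LinearMap.ker (Fintype.linearCombination L b)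

theorem mem_relations {L V ι : Type*} [Field L] [AddCommGroup V] [Module L V] [Fintype ι]
    {b : ι → V} {y : ι → L} : y ∈ relations L b ↔ ∑ i, y i • b i = 0 :=
  Iff.rfl

theorem relations_comp_linearEquiv {L V ι : Type*} [Field L] [AddCommGroup V] [Module L V]
    [Fintype ι] (b : ι → V) (g : V ≃ₗ[L] V) : relations L (g ∘ b) = relations L b := by
  ext y
  have : ∑ i, y i • (g ∘ b) i = g (∑ i, y i • b i) := by simp
  rw [mem_relations, mem_relations, this, g.map_eq_zero_iff]

theorem linearIndependent_iff_relations {L V ι : Type*} [Field L] [AddCommGroup V] [Module L V]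
    [Fintype ι] {b : ι → V} : LinearIndependent L b ↔ ∀ y ∈ relations L b, y = 0 := by
  rw [Fintype.linearIndependent_iff]
  exact ⟨fun h y hy => funext (h y hy), fun h y hy i => congrFun (h y hy) i⟩

section Relations

variable {K L V ι : Type*} [Field K] [Field L] [Algebra K L]
    [AddCommGroup V] [Module K V] [Module L V] [IsScalarTower K L V] [Fintype ι]

/-- `L • x` is the module of relations of `b` exactly if `x` is a relation and the vectors other
than `b i₀`, where `x i₀ ≠ 0`, are independent. -/
theorem relations_eq_span_iff {b : ι → V} {x : ι → L} {i₀ : ι} (hx : x i₀ ≠ 0) :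
    relations L b = Submodule.span L {x} ↔
      x ∈ relations L b ∧ ∀ y ∈ relations L b, y i₀ = 0 → y = 0 := by
  constructor
  · intro h
    rw [h]
    refine ⟨Submodule.mem_span_singleton_self x, fun y hy h0 => ?_⟩
    obtain ⟨c, rfl⟩ := Submodule.mem_span_singleton.1 hy
    have : c = 0 := by simpa [hx] using h0
    rw [this, zero_smul]
  · rintro ⟨h1, h2⟩
    refine le_antisymm (fun y hy => ?_) ((Submodule.span_singleton_le_iff_mem _ _).2 h1)
    rw [Submodule.mem_span_singleton]
    refine ⟨y i₀ / x i₀, ?_⟩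
    have := h2 (y - (y i₀ / x i₀) • x)
      (Submodule.sub_mem _ hy (Submodule.smul_mem _ _ h1)) (by simp [hx])
    exact (sub_eq_zero.1 this).symm

theorem span_range_mulVec_le (M : Matrix ι ι K) (y : ι → L) :
    Submodule.span K (Set.range ((M.map (algebraMap K L)).mulVec y)) ≤
      Submodule.span K (Set.range y) := by
  rw [Submodule.span_le]
  rintro _ ⟨i, rfl⟩
  refine Submodule.sum_mem _ fun j _ => ?_
  change algebraMap K L (M i j) * y j ∈ _
  rw [← Algebra.smul_def]
  exact Submodule.smul_mem _ _ (Submodule.subset_span ⟨j, rfl⟩)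

theorem mem_relations_of_mulVec {M : Matrix ι ι K} {b b' : ι → V}
    (h : ∀ j, b' j = ∑ i, M i j • b i) {y : ι → L} :
    y ∈ relations L b' ↔ (M.map (algebraMap K L)).mulVec y ∈ relations L b := by
  rw [mem_relations, mem_relations]
  refine iff_of_eq (congrArg (· = 0) ?_)
  simp only [h, Finset.smul_sum, Matrix.mulVec, dotProduct, Matrix.map_apply, Finset.sum_smul]
  rw [Finset.sum_comm]
  refine Finset.sum_congr rfl fun i _ => Finset.sum_congr rfl fun j _ => ?_
  rw [mul_comm, mul_smul, algebraMap_smul]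

/-- A change of basis over `K` transforms relations by an invertible matrix over `K`, which does
not change the `K`-span of their entries. -/
theorem exists_relations_eq_span_of_span_eq {b b' : ι → V} (hb : LinearIndependent K b)
    (hb' : LinearIndependent K b')
    (h : Submodule.span K (Set.range b') = Submodule.span K (Set.range b)) {x : ι → L}
    (hx : relations L b = Submodule.span L {x}) :
    ∃ x' : ι → L, Submodule.span K (Set.range x') = Submodule.span K (Set.range x) ∧
      relations L b' = Submodule.span L {x'} := by
  classical
  let B := Basis.span hb
  let B' := (Basis.span hb').map (LinearEquiv.ofEq _ _ h)
  have hB : ∀ i, (B i : V) = b i := fun i => Basis.coe_span_apply hb i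
  have hB' : ∀ i, (B' i : V) = b' i := fun i => by
    rw [Basis.map_apply]
    exact Basis.coe_span_apply hb' i
  have h1 : ∀ j, b' j = ∑ i, B.toMatrix B' i j • b i := by
    intro j
    have := congrArg Subtype.val (B.sum_toMatrix_smul_self B' j)
    rw [hB', AddSubmonoidClass.coe_finsetSum] at this
    simp only [← this, Submodule.coe_smul, hB]
  have h3 : B.toMatrix B' * B'.toMatrix B = 1 := B.toMatrix_mul_toMatrix_flip B'
  have h4 : B'.toMatrix B * B.toMatrix B' = 1 := B'.toMatrix_mul_toMatrix_flip B
  have key : ∀ (M N : Matrix ι ι K), M * N = 1 → ∀ y : ι → L,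
      (M.map (algebraMap K L)).mulVec ((N.map (algebraMap K L)).mulVec y) = y := by
    intro M N hMN y
    rw [Matrix.mulVec_mulVec, ← Matrix.map_mul, hMN,
      Matrix.map_one _ (map_zero _) (map_one _), Matrix.one_mulVec]
  refine ⟨((B'.toMatrix B).map (algebraMap K L)).mulVec x, le_antisymm
    (span_range_mulVec_le _ _) ?_, ?_⟩
  · conv_lhs => rw [← key _ _ h3 x]
    exact span_range_mulVec_le _ _
  · ext y
    rw [mem_relations_of_mulVec h1, hx, Submodule.mem_span_singleton,
      Submodule.mem_span_singleton]
    refine exists_congr fun c => ?_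
    constructor
    · intro hc
      rw [← Matrix.mulVec_smul, hc, key _ _ h4]
    · rintro rfl
      rw [Matrix.mulVec_smul, key _ _ h3]

/-- The tuples whose span is a block: those with a one-dimensional space of relations, generated by
a tuple of elements of `L` with `K`-span in `𝒳`, and, if `W` holds, also those without
relations. -/
def IsBlockTuple (𝒳 : Set (Submodule K L)) (W : Prop) (b : ι → V) : Prop :=
  (W ∧ LinearIndependent L b) ∨
    ∃ x : ι → L, Submodule.span K (Set.range x) ∈ 𝒳 ∧ relations L b = Submodule.span L {x}

open Pointwise

omit [Fintype ι] in
theorem span_range_smul (c : Lˣ) (x : ι → L) :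
    Submodule.span K (Set.range ((c : L) • x)) = c • Submodule.span K (Set.range x) := by
  have : Set.range ((c : L) • x) =
      (DistribSMul.toLinearMap K L c) '' Set.range x := by
    rw [← Set.range_comp]; rfl
  rw [this, ← Submodule.map_span]
  rfl

omit [Module K V] [IsScalarTower K L V] in
/-- Every nonzero relation of a tuple that spans a block has its `K`-span in the family. -/
theorem IsBlockTuple.span_mem {𝒳 : Set (Submodule K L)} {W : Prop}
    (hinv : ∀ a : Lˣ, ∀ X ∈ 𝒳, a • X ∈ 𝒳) {b : ι → V} (hb : IsBlockTuple 𝒳 W b) {y : ι → L}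
    (hy : y ∈ relations L b) (h0 : y ≠ 0) : Submodule.span K (Set.range y) ∈ 𝒳 := by
  rcases hb with ⟨-, hb⟩ | ⟨x, hx, hb⟩
  · exact absurd (linearIndependent_iff_relations.1 hb y hy) h0
  · rw [hb, Submodule.mem_span_singleton] at hy
    obtain ⟨c, rfl⟩ := hy
    have hc : c ≠ 0 := by rintro rfl; simp at h0
    have := hinv (Units.mk0 c hc) _ hx
    rwa [← span_range_smul] at this

theorem isBlockClass_isBlockTuple {n : ℕ} {𝒳 : Set (Submodule K L)} {W : Prop}
    (hinv : ∀ a : Lˣ, ∀ X ∈ 𝒳, a • X ∈ 𝒳) (hdim : ∀ X ∈ 𝒳, 3 ≤ finrank K X) :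
    IsBlockClass K L (IsBlockTuple 𝒳 W : (Fin 2 ⊕ Fin n → V) → Prop) := by
  -- A relation whose entries span a space of dimension at most two is trivial.
  have key : ∀ b : Fin 2 ⊕ Fin n → V, IsBlockTuple 𝒳 W b → ∀ y ∈ relations L b,
      ∀ z : Fin 2 → L, (∀ i, y i ∈ Submodule.span K (Set.range z)) → y = 0 := by
    intro b hb y hy z hz
    by_contra h0
    have h1 := hdim _ (hb.span_mem hinv hy h0)
    have : FiniteDimensional K (Submodule.span K (Set.range z)) :=
      FiniteDimensional.span_of_finite K (Set.finite_range z)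
    have h2 : Submodule.span K (Set.range y) ≤ Submodule.span K (Set.range z) := by
      rw [Submodule.span_le]; rintro _ ⟨i, rfl⟩; exact hz i
    have h3 := Submodule.finrank_mono h2
    have h4 := finrank_range_le_card (R := K) z
    rw [Fintype.card_fin, Set.finrank] at h4
    omega
  have hK : ∀ b : Fin 2 ⊕ Fin n → V, IsBlockTuple 𝒳 W b → LinearIndependent K b := by
    intro b hb
    rw [linearIndependent_iff_relations]
    intro a ha
    have := key b hb (fun i => algebraMap K L (a i))
      (by rw [mem_relations] at ha ⊢; simpa only [algebraMap_smul] using ha) (fun _ => 1)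
      (fun i => by
        rw [Algebra.algebraMap_eq_smul_one]
        exact Submodule.smul_mem _ _ (Submodule.subset_span ⟨0, rfl⟩))
    funext i
    exact (algebraMap K L).injective ((congrFun this i).trans (map_zero _).symm)
  refine ⟨hK, fun b hb => ?_, fun b b' hb hb' h => ?_, fun b hb g => ?_⟩
  · rw [linearIndependent_iff_relations]
    intro y hy
    have := key b hb (Sum.elim y 0)
      (by rw [mem_relations] at hy ⊢; simpa [Fintype.sum_sum_type] using hy) y
      (by
        rintro (i | i)
        · exact Submodule.subset_span ⟨i, rfl⟩
        · exact Submodule.zero_mem _)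
    funext i
    exact congrFun this (Sum.inl i)
  · rcases hb with ⟨hW, hbL⟩ | ⟨x, hx, hbx⟩
    · refine Or.inl ⟨hW, ?_⟩
      have hs : Submodule.span L (Set.range b') = Submodule.span L (Set.range b) := by
        rw [← Submodule.span_span_of_tower K L (Set.range b'), h, Submodule.span_span_of_tower]
      rw [linearIndependent_iff_card_eq_finrank_span] at hbL ⊢
      rw [hbL, Set.finrank, Set.finrank, hs]
    · obtain ⟨x', h1, h2⟩ :=
        exists_relations_eq_span_of_span_eq (hK b (Or.inr ⟨x, hx, hbx⟩)) hb' h hbx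
      exact Or.inr ⟨x', h1 ▸ hx, h2⟩
  · rcases hb with ⟨hW, hbL⟩ | ⟨x, hx, hbx⟩
    · exact Or.inl ⟨hW, hbL.map' (g : V →ₗ[L] V) g.ker⟩
    · exact Or.inr ⟨x, hx, (relations_comp_linearEquiv b g).trans hbx⟩

end Relations

/-! ### Counting the tuples that extend a given pair -/

section CountTuples

variable {K L V : Type*} [Field K] [Field L] [Algebra K L]
    [AddCommGroup V] [Module L V]

/-- A tuple with prescribed relations `L • x` is determined by what remains of it when an entry
`i₀` with `x i₀ ≠ 0` is removed, and the remaining vectors are an arbitrary independent family. -/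
theorem natCard_relations_eq_span [Finite L] [Finite V] {p : Fin 2 → V}
    (hp : LinearIndependent L p) {n : ℕ}
    {x : Fin 2 ⊕ Fin (n + 1) → L} {i₀ : Fin (n + 1)} (hx : x (Sum.inr i₀) ≠ 0) :
    Nat.card {s : Fin (n + 1) → V // relations L (Sum.elim p s) = Submodule.span L {x}} =
      ∏ i ∈ Finset.range n,
        (Nat.card L ^ finrank L V - Nat.card L ^ (2 + i)) := by
  have h := natCard_linearIndependent_sumElim hp n
  rw [Fintype.card_fin] at h
  rw [← h]
  have hsum : ∀ (y : Fin 2 ⊕ Fin (n + 1) → L) (s : Fin (n + 1) → V),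
      ∑ i, y i • Sum.elim p s i = y (Sum.inr i₀) • s i₀ +
        ∑ i, y (Sum.map id i₀.succAbove i) • Sum.elim p (s ∘ i₀.succAbove) i := by
    intro y s
    rw [Fintype.sum_sum_type, Fintype.sum_sum_type, Fin.sum_univ_succAbove _ i₀]
    simp only [Sum.elim_inl, Sum.elim_inr, Sum.map_inl, Sum.map_inr, id, Function.comp_apply]
    abel
  have hli : ∀ s : Fin (n + 1) → V,
      (∀ y ∈ relations L (Sum.elim p s), y (Sum.inr i₀) = 0 → y = 0) ↔
        LinearIndependent L (Sum.elim p (s ∘ i₀.succAbove)) := by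
    intro s
    rw [linearIndependent_iff_relations]
    constructor
    · intro h z hz
      let y : Fin 2 ⊕ Fin (n + 1) → L :=
        Sum.elim (z ∘ Sum.inl) (i₀.insertNth 0 (z ∘ Sum.inr))
      have hyz : ∀ i, y (Sum.map id i₀.succAbove i) = z i := by
        rintro (i | i) <;> simp [y]
      have hy0 : y (Sum.inr i₀) = 0 := by simp [y]
      have hy := h y (by
        rw [mem_relations, hsum, hy0, zero_smul, zero_add]
        simpa only [hyz] using mem_relations.1 hz) hy0
      funext i
      rw [← hyz, hy]; rfl
    · intro h y hy hy0
      rw [mem_relations, hsum, hy0, zero_smul, zero_add] at hy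
      have h0 := h (fun i => y (Sum.map id i₀.succAbove i)) hy
      funext i
      rcases i with i | i
      · exact congrFun h0 (Sum.inl i)
      · rcases Fin.eq_self_or_eq_succAbove i₀ i with rfl | ⟨j, rfl⟩
        · exact hy0
        · exact congrFun h0 (Sum.inr j)
  let f : {s : Fin (n + 1) → V // relations L (Sum.elim p s) = Submodule.span L {x}} →
      {s : Fin n → V // LinearIndependent L (Sum.elim p s)} := fun s =>
    ⟨s.1 ∘ i₀.succAbove, (hli s.1).1 ((relations_eq_span_iff hx).1 s.2).2⟩
  refine Nat.card_congr (Equiv.ofBijective f ⟨?_, ?_⟩)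
  · rintro ⟨s, hs⟩ ⟨s', hs'⟩ hss
    have hss : s ∘ i₀.succAbove = s' ∘ i₀.succAbove := congrArg Subtype.val hss
    have h1 := ((relations_eq_span_iff hx).1 hs).1
    have h2 := ((relations_eq_span_iff hx).1 hs').1
    rw [mem_relations, hsum] at h1 h2
    rw [hss, ← h2, add_left_inj] at h1
    have h3 := smul_right_injective V hx h1
    apply Subtype.ext
    funext i
    rcases Fin.eq_self_or_eq_succAbove i₀ i with rfl | ⟨j, rfl⟩
    · exact h3
    · exact congrFun hss j
  · rintro ⟨s, hs⟩
    let v : V := -((x (Sum.inr i₀))⁻¹ •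
      ∑ i, x (Sum.map id i₀.succAbove i) • Sum.elim p s i)
    have hcomp : (i₀.insertNth v s : Fin (n + 1) → V) ∘ i₀.succAbove = s := by
      funext j; simp
    refine ⟨⟨i₀.insertNth v s, (relations_eq_span_iff hx).2 ⟨?_, (hli _).2 ?_⟩⟩,
      Subtype.ext hcomp⟩
    · rw [mem_relations, hsum, hcomp, Fin.insertNth_apply_same, smul_neg, smul_inv_smul₀ hx,
        neg_add_cancel]
    · rwa [hcomp]

open Pointwise

/-- All generators of a line `L • x` belong to the invariant family if `x` does. -/
theorem natCard_generators [Finite L] {ι : Type*} {𝒳 : Set (Submodule K L)}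
    (hinv : ∀ a : Lˣ, ∀ X ∈ 𝒳, a • X ∈ 𝒳) {x : ι → L}
    (hx : Submodule.span K (Set.range x) ∈ 𝒳) (hx0 : x ≠ 0) :
    Nat.card {y : ι → L // Submodule.span K (Set.range y) ∈ 𝒳 ∧
      Submodule.span L {x} = Submodule.span L {y}} = Nat.card L - 1 := by
  rw [← Nat.card_units]
  symm
  let f : Lˣ → {y : ι → L // Submodule.span K (Set.range y) ∈ 𝒳 ∧
      Submodule.span L {x} = Submodule.span L {y}} := fun c =>
    ⟨(c : L) • x, by rw [span_range_smul]; exact hinv c _ hx,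
      (Submodule.span_singleton_smul_eq c.isUnit x).symm⟩
  refine Nat.card_congr (Equiv.ofBijective f ⟨?_, ?_⟩)
  · intro c d hcd
    exact Units.ext (smul_left_injective L hx0 (congrArg Subtype.val hcd))
  · rintro ⟨y, hy, hxy⟩
    obtain ⟨c, hc⟩ := Submodule.span_singleton_eq_span_singleton.1 hxy
    exact ⟨c, Subtype.ext hc⟩

theorem natCard_span_mem [Finite K] [Finite L] {ι : Type*} [Fintype ι]
    (𝒳 : Finset (Submodule K L)) :
    Nat.card {x : ι → L // Submodule.span K (Set.range x) ∈ 𝒳} =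
      ∑ X ∈ 𝒳, ∏ i ∈ Finset.range (finrank K X),
        (Nat.card K ^ Fintype.card ι - Nat.card K ^ i) := by
  have e : {x : ι → L // Submodule.span K (Set.range x) ∈ 𝒳} ≃
      Σ X : 𝒳, {x : ι → L // Submodule.span K (Set.range x) = X} :=
    { toFun := fun x => ⟨⟨_, x.2⟩, x.1, rfl⟩
      invFun := fun x => ⟨x.2.1, x.2.2.symm ▸ x.1.2⟩
      left_inv := fun x => rfl
      right_inv := by
        rintro ⟨⟨X, hX⟩, x, hx⟩
        dsimp only at hx
        subst hx
        rfl }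
  rw [Nat.card_congr e, Nat.card_sigma, ← Finset.sum_coe_sort 𝒳]
  exact Finset.sum_congr rfl fun X _ => natCard_span_range_eq X.1

/-- Double counting of the pairs of a tuple `s` and a generator `x` of the module of relations of
the extended tuple. -/
theorem natCard_relations_mul [Finite K] [Finite L] [Finite V] {p : Fin 2 → V}
    (hp : LinearIndependent L p) {n : ℕ} {𝒳 : Finset (Submodule K L)}
    (hinv : ∀ a : Lˣ, ∀ X ∈ 𝒳, a • X ∈ 𝒳) (hdim : ∀ X ∈ 𝒳, 3 ≤ finrank K X) :
    Nat.card {s : Fin (n + 1) → V // ∃ x : Fin 2 ⊕ Fin (n + 1) → L,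
        Submodule.span K (Set.range x) ∈ 𝒳 ∧
          relations L (Sum.elim p s) = Submodule.span L {x}} * (Nat.card L - 1) =
      (∑ X ∈ 𝒳, ∏ i ∈ Finset.range (finrank K X),
        (Nat.card K ^ (n + 3) - Nat.card K ^ i)) *
      ∏ i ∈ Finset.range n, (Nat.card L ^ finrank L V - Nat.card L ^ (2 + i)) := by
  -- A tuple with span of dimension at least three has a nonzero entry beyond the first two.
  have hne : ∀ x : Fin 2 ⊕ Fin (n + 1) → L, Submodule.span K (Set.range x) ∈ 𝒳 →
      ∃ i₀, x (Sum.inr i₀) ≠ 0 := by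
    intro x hx
    by_contra! h0
    have h1 := hdim _ hx
    have h2 : Submodule.span K (Set.range x) ≤ Submodule.span K (Set.range (x ∘ Sum.inl)) := by
      rw [Submodule.span_le]
      rintro _ ⟨i | i, rfl⟩
      · exact Submodule.subset_span ⟨i, rfl⟩
      · rw [h0]; exact Submodule.zero_mem _
    have h3 := Submodule.finrank_mono h2
    have h4 := finrank_range_le_card (R := K) (x ∘ Sum.inl)
    rw [Fintype.card_fin, Set.finrank] at h4
    omega
  have hcard : Nat.card {x : Fin 2 ⊕ Fin (n + 1) → L // Submodule.span K (Set.range x) ∈ 𝒳} =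
      ∑ X ∈ 𝒳, ∏ i ∈ Finset.range (finrank K X),
        (Nat.card K ^ (n + 3) - Nat.card K ^ i) := by
    rw [natCard_span_mem, Fintype.card_sum, Fintype.card_fin, Fintype.card_fin,
      show 2 + (n + 1) = n + 3 by omega]
  rw [← hcard]
  have h1 : ∀ s : {s : Fin (n + 1) → V // ∃ x : Fin 2 ⊕ Fin (n + 1) → L,
        Submodule.span K (Set.range x) ∈ 𝒳 ∧
          relations L (Sum.elim p s) = Submodule.span L {x}},
      Nat.card {x : Fin 2 ⊕ Fin (n + 1) → L // Submodule.span K (Set.range x) ∈ 𝒳 ∧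
        relations L (Sum.elim p s.1) = Submodule.span L {x}} = Nat.card L - 1 := by
    rintro ⟨s, x, hx, hs⟩
    rw [← natCard_generators (𝒳 := (𝒳 : Set (Submodule K L))) hinv hx fun h => by
      obtain ⟨i, hi⟩ := hne x hx
      exact hi (congrFun h _)]
    simp only [hs]
    rfl
  have h2 : ∀ x : {x : Fin 2 ⊕ Fin (n + 1) → L // Submodule.span K (Set.range x) ∈ 𝒳},
      Nat.card {s : Fin (n + 1) → V // relations L (Sum.elim p s) = Submodule.span L {x.1}} =
        ∏ i ∈ Finset.range n, (Nat.card L ^ finrank L V - Nat.card L ^ (2 + i)) := by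
    rintro ⟨x, hx⟩
    obtain ⟨i₀, hi₀⟩ := hne x hx
    exact natCard_relations_eq_span hp hi₀
  rw [← natCard_sigma_of_const h1, ← natCard_sigma_of_const h2]
  exact Nat.card_congr
    { toFun := fun z => ⟨⟨z.2.1, z.2.2.1⟩, z.1.1, z.2.2.2⟩
      invFun := fun z => ⟨⟨z.2.1, z.1.1, z.1.2, z.2.2⟩, z.1.1, z.1.2, z.2.2⟩
      left_inv := fun _ => rfl
      right_inv := fun _ => rfl }

theorem natCard_isBlockTuple [Finite K] [Finite L] [Finite V] {p : Fin 2 → V}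
    (hp : LinearIndependent L p) {n : ℕ} {𝒳 : Finset (Submodule K L)} (W : Prop) [Decidable W]
    (hinv : ∀ a : Lˣ, ∀ X ∈ 𝒳, a • X ∈ 𝒳) (hdim : ∀ X ∈ 𝒳, 3 ≤ finrank K X) :
    Nat.card {s : Fin (n + 1) → V //
        IsBlockTuple (𝒳 : Set (Submodule K L)) W (Sum.elim p s)} * (Nat.card L - 1) =
      (∑ X ∈ 𝒳, ∏ i ∈ Finset.range (finrank K X),
        (Nat.card K ^ (n + 3) - Nat.card K ^ i)) *
      ∏ i ∈ Finset.range n, (Nat.card L ^ finrank L V - Nat.card L ^ (2 + i)) +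
      (if W then ∏ i ∈ Finset.range (n + 1),
        (Nat.card L ^ finrank L V - Nat.card L ^ (2 + i)) else 0) * (Nat.card L - 1) := by
  classical
  have hor : Nat.card {s : Fin (n + 1) → V //
        IsBlockTuple (𝒳 : Set (Submodule K L)) W (Sum.elim p s)} =
      Nat.card {s : Fin (n + 1) → V // W ∧ LinearIndependent L (Sum.elim p s)} +
      Nat.card {s : Fin (n + 1) → V // ∃ x : Fin 2 ⊕ Fin (n + 1) → L,
        Submodule.span K (Set.range x) ∈ 𝒳 ∧
          relations L (Sum.elim p s) = Submodule.span L {x}} := by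
    rw [← Nat.card_sum]
    refine Nat.card_congr (subtypeOrEquiv _ _ ?_)
    rw [Pi.disjoint_iff]
    intro s
    rw [Prop.disjoint_iff]
    rintro ⟨⟨-, h⟩, x, hx, hs⟩
    have hx0 := linearIndependent_iff_relations.1 h x
      (hs ▸ Submodule.mem_span_singleton_self x)
    have hle : Submodule.span K (Set.range x) ≤ ⊥ := by
      rw [Submodule.span_le]
      rintro _ ⟨i, rfl⟩
      exact congrFun hx0 i
    have := hdim _ hx
    rw [le_bot_iff.1 hle, finrank_bot] at this
    omega
  rw [hor, add_mul, natCard_relations_mul hp hinv hdim, add_comm]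
  congr 2
  by_cases hW : W
  · have := natCard_linearIndependent_sumElim hp (n + 1)
    rw [Fintype.card_fin] at this
    simpa [hW] using this
  · simp [hW]

end CountTuples

/-! ### The index of the design -/

theorem natCast_prod_pow_sub {q m a n : ℕ} (hq : 1 ≤ q) (h : a + n ≤ m + 1) :
    ((∏ i ∈ Finset.range n, (q ^ m - q ^ (a + i)) : ℕ) : ℚ) =
      ∏ i ∈ Finset.range n, ((q : ℚ) ^ m - (q : ℚ) ^ (a + i)) := by
  rw [Nat.cast_prod]
  refine Finset.prod_congr rfl fun i hi => ?_
  have hi := Finset.mem_range.1 hi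
  rw [Nat.cast_sub (Nat.pow_le_pow_right hq (by omega))]
  push_cast
  rfl

/-- Both sides are `q ^ u - 1` times the number of tuples extending a given pair that one orbit of
subspaces of `L` contributes; on the left, the last product is the number of extensions of a pair to
a basis of a block. -/
theorem orbitIndex_mul {q m l n r u : ℕ} (hq : 1 < q) (hr : r ≤ n + 2) (hu : u ≠ 0) :
    orbitIndex q m l (n + 3) r u * (((q : ℚ) ^ u - 1) *
        ∏ i ∈ Finset.range (n + 1), ((q : ℚ) ^ (n + 3) - (q : ℚ) ^ (2 + i))) =
      (∏ i ∈ Finset.range (r + 1), ((q : ℚ) ^ (n + 3) - (q : ℚ) ^ i)) *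
        ∏ i ∈ Finset.range n, (((q : ℚ) ^ l) ^ m - ((q : ℚ) ^ l) ^ (2 + i)) := by
  have hq' : (1 : ℚ) < q := by exact_mod_cast hq
  have hu' : (q : ℚ) ^ u - 1 ≠ 0 := (sub_pos.2 (one_lt_pow₀ hq' hu)).ne'
  have h1 : Finset.Icc (r + 1) (n + 3 - 1) = Finset.Ico (r + 1) (n + 3) := by
    ext; simp only [Finset.mem_Icc, Finset.mem_Ico]; omega
  have h2 : Finset.Icc 2 (n + 3 - 2) = Finset.Ico 2 (n + 2) := by
    ext; simp only [Finset.mem_Icc, Finset.mem_Ico]; omega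
  have hP : ∏ j ∈ Finset.Ico (r + 1) (n + 3), ((q : ℚ) ^ (n + 3) - (q : ℚ) ^ j) ≠ 0 := by
    refine Finset.prod_ne_zero_iff.2 fun j hj => (sub_pos.2 ?_).ne'
    exact pow_lt_pow_right₀ hq' (Finset.mem_Ico.1 hj).2
  have h3 := Finset.prod_range_mul_prod_Ico (fun j => (q : ℚ) ^ (n + 3) - (q : ℚ) ^ j)
    (show r + 1 ≤ n + 3 by omega)
  have h4 := Finset.prod_range_mul_prod_Ico (fun j => (q : ℚ) ^ (n + 3) - (q : ℚ) ^ j)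
    (show 2 ≤ n + 3 by omega)
  rw [Finset.prod_Ico_eq_prod_range _ 2, Finset.prod_range_succ, Finset.prod_range_one, pow_zero,
    pow_one, show n + 3 - 2 = n + 1 by omega] at h4
  rw [orbitIndex, h1, h2, div_mul_eq_mul_div, div_eq_iff (mul_ne_zero hu' hP),
    Finset.prod_Ico_eq_prod_range _ 2, Nat.add_sub_cancel]
  simp only [← pow_mul, mul_comm _ l]
  linear_combination (((q : ℚ) ^ u - 1) *
    ∏ i ∈ Finset.range n, ((q : ℚ) ^ (l * m) - (q : ℚ) ^ (l * (2 + i)))) * (h4 - h3)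

theorem fullOrbitIndex_mul {q m l n : ℕ} (hq : 1 < q) (hl : 1 ≤ l) (hm : n + 2 ≤ m) :
    fullOrbitIndex q m l (n + 3) *
        ∏ i ∈ Finset.range (n + 1), ((q : ℚ) ^ (n + 3) - (q : ℚ) ^ (2 + i)) =
      ∏ i ∈ Finset.range (n + 1), (((q : ℚ) ^ l) ^ m - ((q : ℚ) ^ l) ^ (2 + i)) := by
  have hq' : (1 : ℚ) < q := by exact_mod_cast hq
  have h1 : Finset.Icc 2 (n + 3 - 1) = Finset.Ico 2 (n + 3) := by
    ext; simp only [Finset.mem_Icc, Finset.mem_Ico]; omega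
  have hsum : (n + 3).choose 2 - 1 = ∑ i ∈ Finset.range (n + 1), (2 + i) := by
    have := Finset.sum_range_add_sum_Ico (fun j => j) (show 2 ≤ n + 3 by omega)
    rw [Finset.sum_Ico_eq_sum_range, Finset.sum_range_id (n + 3), ← Nat.choose_two_right,
      show n + 3 - 2 = n + 1 by omega] at this
    simp only [Finset.sum_range_succ _ 1, Finset.sum_range_one] at this
    omega
  rw [fullOrbitIndex, h1, Finset.prod_Ico_eq_prod_range, show n + 3 - 2 = n + 1 by omega, hsum,
    Finset.mul_sum, ← Finset.prod_pow_eq_pow_sum, ← Finset.prod_mul_distrib,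
    ← Finset.prod_mul_distrib]
  refine Finset.prod_congr rfl fun i hi => ?_
  have hi := Finset.mem_range.1 hi
  have hd : (q : ℚ) ^ (n + 3 - (2 + i)) - 1 ≠ 0 :=
    (sub_pos.2 (one_lt_pow₀ hq' (by omega))).ne'
  have e1 : (q : ℚ) ^ (n + 3) = (q : ℚ) ^ (2 + i) * (q : ℚ) ^ (n + 3 - (2 + i)) := by
    rw [← pow_add]; congr 1; omega
  have e2 : ((q : ℚ) ^ l) ^ m = ((q : ℚ) ^ l) ^ (2 + i) * (q : ℚ) ^ ((m - (2 + i)) * l) := by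
    rw [mul_comm _ l, pow_mul, ← pow_add]; congr 1; omega
  have e3 : ((q : ℚ) ^ l) ^ (2 + i) = (q : ℚ) ^ ((l - 1) * (2 + i)) * (q : ℚ) ^ (2 + i) := by
    rw [← pow_mul, ← pow_add]
    congr 1
    obtain ⟨c, rfl⟩ := Nat.exists_eq_add_of_le' hl
    rw [Nat.add_sub_cancel]
    ring
  rw [e2, e3, e1]
  field_simp

theorem mainTheorem1 {K L V : Type*} [Field K] [Finite K] [Field L] [Algebra K L]
    [AddCommGroup V] [Module K V] [Module L V] [IsScalarTower K L V]
    (q m l k : ℕ) (hq : Nat.card K = q) (hl : Module.finrank K L = l)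
    (hm : Module.finrank L V = m) (hk : 3 ≤ k) (hkml : k ≤ min (m + 1) l)
    (w : ℕ → ℕ → ℕ) (w₀ : ℕ)
    (hw : ∀ r ∈ Finset.Icc 2 (k - 1), ∀ u ∈ (Nat.gcd (r + 1) l).divisors,
      (w r u : ℚ) ≤ singerOrbitNumber q l (r + 1) u)
    (hw₀ : w₀ = 0 ∨ w₀ = 1) :
    ∃ (lam : ℕ) (B : Multiset (Submodule K V)),
      (lam : ℚ) =
        (∑ r ∈ Finset.Icc 2 (k - 1), ∑ u ∈ (Nat.gcd (r + 1) l).divisors,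
          (w r u : ℚ) * orbitIndex q m l k r u) + (w₀ : ℚ) * fullOrbitIndex q m l k ∧
      IsQGDD (m * l) l k lam (desarguesianSpread K L V) B ∧
      B.Nodup ∧
      ∀ g : V ≃ₗ[L] V,
        IsGDDAutomorphism (desarguesianSpread K L V) B (g.restrictScalars K) := by
  classical
  obtain ⟨n, rfl⟩ := Nat.exists_eq_add_of_le' hk
  have hkm : n + 2 ≤ m := by have := hkml.trans (min_le_left _ _); omega
  have hkl : n + 3 ≤ l := hkml.trans (min_le_right _ _)
  have : Module.Finite K L := Module.finite_of_finrank_pos (by omega)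
  have : Module.Finite L V := Module.finite_of_finrank_pos (by omega)
  have : Finite L := Module.finite_of_finite K
  have : Finite V := Module.finite_of_finite L
  have hq1 : 1 < q := hq ▸ Finite.one_lt_card
  have hQ : Nat.card L = q ^ l := by rw [natCard_eq_pow_finrank (K := K), hq, hl]
  set I : Finset (Σ _ : ℕ, ℕ) :=
    (Finset.Icc 2 (n + 3 - 1)).sigma fun r => (Nat.gcd (r + 1) l).divisors with hI
  have hIr : ∀ i ∈ I, 2 ≤ i.1 ∧ i.1 ≤ n + 2 := fun i hi =>
    Finset.mem_Icc.1 (Finset.mem_sigma.1 hi).1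
  have hIu : ∀ i ∈ I, i.2 ∣ Nat.gcd (i.1 + 1) l := fun i hi =>
    Nat.dvd_of_mem_divisors (Finset.mem_sigma.1 hi).2
  obtain ⟨𝒳, h𝒳dim, hinv, hsum⟩ := exists_invariant_union (K := K) (L := L) (I := I)
    (d := fun i => i.1 + 1) (u := fun i => i.2) (w := fun i => w i.1 i.2)
    (by
      rintro ⟨r, u⟩ - ⟨r', u'⟩ - h
      simp only [Prod.mk.injEq, add_left_inj] at h
      rw [h.1, h.2])
    (fun i hi => by have := hIr i hi; omega) (by rw [hl]; exact hIu)
    (fun i hi => by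
      rw [hq, hl]
      exact hw i.1 (Finset.mem_sigma.1 hi).1 i.2 (Finset.mem_sigma.1 hi).2)
  have hdim : ∀ X ∈ 𝒳, 3 ≤ finrank K X := fun X hX => by
    obtain ⟨i, hi, hXi⟩ := h𝒳dim X hX
    have := hIr i hi
    omega
  -- The blocks are the `K`-spans of these tuples.
  let P : (Fin 2 ⊕ Fin (n + 1) → V) → Prop := IsBlockTuple (𝒳 : Set (Submodule K L)) (w₀ = 1)
  have hP : IsBlockClass K L P := isBlockClass_isBlockTuple hinv hdim
  -- The number of extensions of a pair to a basis of a given block.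
  let D : ℕ := ∏ i ∈ Finset.range (n + 1), (q ^ (2 + (n + 1)) - q ^ (2 + i))
  have hD : 0 < D := Finset.prod_pos fun i hi => Nat.sub_pos_of_lt
    (Nat.pow_lt_pow_right hq1 (by simpa using hi))
  have hl1 : 0 < q ^ l - 1 := Nat.sub_pos_of_lt (Nat.one_lt_pow (by omega) hq1)
  -- The number of tuples that extend a given pair, multiplied by the number of units of `L`.
  let N : ℕ := (∑ X ∈ 𝒳, ∏ i ∈ Finset.range (finrank K X), (q ^ (n + 3) - q ^ i)) *
      ∏ i ∈ Finset.range n, ((q ^ l) ^ m - (q ^ l) ^ (2 + i)) +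
      (if w₀ = 1 then ∏ i ∈ Finset.range (n + 1),
        ((q ^ l) ^ m - (q ^ l) ^ (2 + i)) else 0) * (q ^ l - 1)
  have hcount : ∀ p : Fin 2 → V, LinearIndependent L p →
      {S | S ∈ spansOf K P ∧ Submodule.span K (Set.range p) ≤ S}.ncard * D * (q ^ l - 1) = N := by
    intro p hp
    have h1 := hP.ncard_mul (hp.restrict_scalars' K)
    have h2 := natCard_isBlockTuple hp (n := n) (w₀ = 1) hinv hdim
    rw [← h1, hQ, hm, hq] at h2
    exact h2
  -- The index is read off at one pair, which exists because `2 ≤ m`.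
  obtain ⟨p, hp⟩ := exists_linearIndependent_of_le_finrank (R := L) (M := V) (n := 2) (by omega)
  let lam : ℕ := {S | S ∈ spansOf K P ∧ Submodule.span K (Set.range p) ≤ S}.ncard
  have hlam : ∀ p' : Fin 2 → V, LinearIndependent L p' →
      {S | S ∈ spansOf K P ∧ Submodule.span K (Set.range p') ≤ S}.ncard = lam := fun p' hp' =>
    Nat.eq_of_mul_eq_mul_right hD (Nat.eq_of_mul_eq_mul_right hl1
      ((hcount p' hp').trans (hcount p hp).symm))
  have hB : ∀ S, S ∈ (Set.toFinite (spansOf K P)).toFinset.val ↔ S ∈ spansOf K P := fun S =>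
    (Set.toFinite (spansOf K P)).mem_toFinset
  refine ⟨lam, (Set.toFinite (spansOf K P)).toFinset.val, ?_, ?_, Finset.nodup _, fun g =>
    isGDDAutomorphism_of_map_mem (Finset.nodup _) (fun g S hS => ?_) g⟩
  · have hc : ((q ^ l - 1 : ℕ) : ℚ) = (q : ℚ) ^ l - 1 := by
      rw [Nat.cast_sub (Nat.one_le_pow _ _ (by omega))]; push_cast; rfl
    have hq' : (1 : ℚ) < q := by exact_mod_cast hq1
    have hpow : ∀ j, j ≠ 0 → (q : ℚ) ^ j - 1 ≠ 0 := fun j hj =>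
      (sub_pos.2 (one_lt_pow₀ hq' hj)).ne'
    have hql : (q : ℚ) ^ l - 1 ≠ 0 := hpow l (by omega)
    have hDq : (D : ℚ) = ∏ i ∈ Finset.range (n + 1), ((q : ℚ) ^ (n + 3) - (q : ℚ) ^ (2 + i)) := by
      rw [natCast_prod_pow_sub hq1.le (by omega), show 2 + (n + 1) = n + 3 by omega]
    have hD0 : (D : ℚ) ≠ 0 := by exact_mod_cast hD.ne'
    have hM : ∀ n', n' ≤ n + 1 →
        ((∏ i ∈ Finset.range n', ((q ^ l) ^ m - (q ^ l) ^ (2 + i)) : ℕ) : ℚ) =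
          ∏ i ∈ Finset.range n', (((q : ℚ) ^ l) ^ m - ((q : ℚ) ^ l) ^ (2 + i)) := fun n' hn' => by
      rw [natCast_prod_pow_sub (Nat.one_le_pow _ _ (by omega)) (by omega)]
      push_cast
      rfl
    have hsum' := hsum fun d => ((∏ i ∈ Finset.range d, (q ^ (n + 3) - q ^ i) : ℕ) : ℚ)
    rw [hq, hl] at hsum'
    -- The contribution of one pair of parameters, multiplied by the common factor.
    have horb : ∀ i ∈ I, (w i.1 i.2 : ℚ) * (((q : ℚ) ^ l - 1) / ((q : ℚ) ^ i.2 - 1)) *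
          ((∏ j ∈ Finset.range (i.1 + 1), (q ^ (n + 3) - q ^ j) : ℕ) : ℚ) *
          ∏ j ∈ Finset.range n, (((q : ℚ) ^ l) ^ m - ((q : ℚ) ^ l) ^ (2 + j)) =
        (w i.1 i.2 : ℚ) * orbitIndex q m l (n + 3) i.1 i.2 * (D * ((q : ℚ) ^ l - 1)) := by
      intro i hi
      have hu0 : i.2 ≠ 0 := by
        intro h0
        have := hIu i hi
        rw [h0, zero_dvd_iff] at this
        exact (Nat.gcd_pos_of_pos_left _ (Nat.succ_pos i.1)).ne' this
      have h1 := orbitIndex_mul (m := m) (l := l) hq1 (hIr i hi).2 hu0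
      have h2 := natCast_prod_pow_sub (q := q) (m := n + 3) (a := 0) (n := i.1 + 1) hq1.le
        (by have := hIr i hi; omega)
      simp only [zero_add] at h2
      have h3 := hpow _ hu0
      rw [← hDq] at h1
      rw [h2, mul_assoc, ← h1]
      field_simp
    have hN := congrArg (Nat.cast : ℕ → ℚ) (hcount p hp)
    simp only [N] at hN
    rw [Nat.cast_mul, Nat.cast_mul, hc, Nat.cast_add, Nat.cast_mul, Nat.cast_mul, hc,
      Nat.cast_sum, hsum', hM n (by omega), Finset.sum_mul, Finset.sum_congr rfl horb,
      ← Finset.sum_mul] at hN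
    have hfull : (((if w₀ = 1 then ∏ i ∈ Finset.range (n + 1),
        ((q ^ l) ^ m - (q ^ l) ^ (2 + i)) else 0 : ℕ) : ℕ) : ℚ) =
          w₀ * fullOrbitIndex q m l (n + 3) * D := by
      rw [hDq, mul_assoc, fullOrbitIndex_mul hq1 (by omega) hkm, ← hM _ le_rfl]
      rcases hw₀ with rfl | rfl <;> simp
    rw [hfull] at hN
    rw [← Finset.sum_sigma (Finset.Icc 2 (n + 3 - 1)) (fun r => (Nat.gcd (r + 1) l).divisors)
      (fun i => (w i.1 i.2 : ℚ) * orbitIndex q m l (n + 3) i.1 i.2)]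
    refine mul_right_cancel₀ (mul_ne_zero hD0 hql) ?_
    rw [← mul_assoc]
    refine hN.trans ?_
    ring
  · have := hP.isQGDD (Finset.nodup _) hB hlam
    rw [hm, hl, show 2 + (n + 1) = n + 3 by omega] at this
    exact this
  · rw [hB] at hS ⊢
    obtain ⟨b, hb, rfl⟩ := hS
    refine ⟨g ∘ b, hP.map b hb g, ?_⟩
    rw [Set.range_comp, Submodule.map_span]
    rfl
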